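/- **Theorem (Symmetry of solitary-wave solutions).** Let $m(\xi)=\left(\frac{\tanh \xi}{\xi}\right)^{1/2}$ (with $m(0)=1$), and let $K=\mathcal F^{-1}(m)$, that is, $K(x)=\frac1{2\pi}\lim_{R\to\infty}\int_{-R}^{R} m(\xi)e^{ix\xi}\,d\xi$ for $x\neq 0$. For every $c>1$ there is $\nu>0$, depending only on $c$, such that the following holds. Let $\varphi:\mathbb R\to\mathbb R$ be a continuous, bounded, not identically zero function with $\varphi(x)\to0$ as $x\to\pm\infty$ that satisfies $$-c\varphi+\varphi^2+K*\varphi=0$$ pointwise on $\mathbb R$. For $\lambda\in\mathbb R$ put $\varphi_\lambda(x)=\varphi(2\lambda-x)$, $\Sigma_\lambda=(\lambda,\infty)$ and $\Sigma_\lambda^-=\{x\in\Sigma_\lambda : \varphi(x)<\varphi_\lambda(x)\}$. Then there is $N>0$ such that $\Sigma_\lambda^-=\emptyset$ for all $\lambda\le -N$, and there is $\lambda_0\in\mathbb R$ such that: 1. for every $N>0$ with $\Sigma_\lambda^-=\emptyset$ for all $\lambda\le-N$, the process of starting at $\lambda=-N$ and moving $\lambda$ to the right as long as $\varphi\ge\varphi_\lambda$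 on $\Sigma_\lambda$ stops exactly at $\lambda_0$; that is, $\lambda_0$ is the largest $\lambda\ge -N$ such that $\varphi\ge\varphi_\mu$ on $\Sigma_\mu$ for all $\mu\in[-N,\lambda]$; 2. $\varphi=\varphi_{\lambda_0}$ on $\Sigma_{\lambda_0}$, and hence $\varphi$ is symmetric about $\lambda_0$: $\varphi(x)=\varphi(2\lambda_0-x)$ for all $x\in\mathbb R$; 3. $\varphi$ has exactly one crest (local maximum), located at $\lambda_0$; 4. $\varphi$ is strictly decreasing on $[\lambda_0,\infty)$ and decays exponentially: there is a constant $C$ with $|\varphi(x)|\le C e^{-\nu|x|}$ for all $x\in\mathbb R$. -/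

import Mathlib

open Set Filter Topology MeasureTheory

namespace Whitham

noncomputable section

/-- The symbol `m(ξ) = (tanh ξ / ξ)^(1/2)` of the Whitham equation, continuously extended by
`m(0) = 1`. -/
def symbol (ξ : ℝ) : ℝ := if ξ = 0 then 1 else Real.sqrt (Real.tanh ξ / ξ)

/-- The inverse Fourier transform of an even real symbol `f`, with the normalization
`𝓕⁻¹ f (x) = (2π)⁻¹ ∫ f(ξ) e^{ixξ} dξ`, the integral being read as the improper integral
`lim_{R → ∞} ∫_{-R}^{R}`. (The Whitham symbol is not absolutely integrable, but, being even and
decreasing to `0` on `(0, ∞)`, its improper integral converges for every `x ≠ 0`; the value at the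
single point `x = 0`, where it diverges, is irrelevant for convolutions.) -/
def invFourier (f : ℝ → ℝ) (x : ℝ) : ℝ :=
  (limUnder atTop fun R : ℝ =>
    (2 * (Real.pi : ℂ))⁻¹ *
      ∫ ξ in (-R)..R, (f ξ : ℂ) * Complex.exp (Complex.I * (x : ℂ) * (ξ : ℂ))).re

/-- The Whitham kernel `K = 𝓕⁻¹ m`. -/
def kernel : ℝ → ℝ := invFourier symbol

/-- The convolution `(f * g)(x) = ∫ f(y) g(x - y) dy` of real functions. -/
def conv (f g : ℝ → ℝ) : ℝ → ℝ :=
  MeasureTheory.convolution f g (ContinuousLinearMap.mul ℝ ℝ) volume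

/-- `φ` is a solution of the steady Whitham equation with wave speed `c`: a continuous bounded
real function with `-c φ + φ² + K * φ = 0` pointwise. -/
structure IsSteadySolution (c : ℝ) (φ : ℝ → ℝ) : Prop where
  continuous : Continuous φ
  bounded : ∃ M : ℝ, ∀ x, |φ x| ≤ M
  equation : ∀ x, -c * φ x + φ x ^ 2 + conv kernel φ x = 0

/-- The reflection `φ_a = φ(2a - ·)` of `φ` about `a`. -/
def reflect (φ : ℝ → ℝ) (a : ℝ) (x : ℝ) : ℝ := φ (2 * a - x)

/-- The half line `Σ_a = {x | x > a}`. -/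
def halfLine (a : ℝ) : Set ℝ := {x | a < x}

/-- The set `Σ_a⁻ = {x ∈ Σ_a | φ(x) < φ_a(x)}`. -/
def badSet (φ : ℝ → ℝ) (a : ℝ) : Set ℝ := {x ∈ halfLine a | φ x < reflect φ a x}

/-- The positions `a ≥ -N` that the plane reaches when it starts at `-N` and is moved to the right
as long as `φ ≥ φ_b` on `Σ_b` for the current position `b`. -/
def reachable (φ : ℝ → ℝ) (N : ℝ) : Set ℝ :=
  {a | -N ≤ a ∧ ∀ b ∈ Icc (-N) a, ∀ x ∈ halfLine b, reflect φ b x ≤ φ x}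

end

end Whitham

namespace Whitham

/-! ### The holomorphic branch of `√(tanh z / z)` on the right half-plane -/

/-! The kernel is, up to a factor, the Laplace transform in `|x|` of a nonnegative density. On the
first quadrant `tanh z / z` has nonpositive imaginary part, so its square root has a holomorphic
branch there. The Fourier integral can then be rotated onto the imaginary axis, where the symbol
becomes `√(tan s / s)` and only the part with `tan s < 0` contributes (`kernel_eq`). Positivity,
strict decay, mass at most 1, an exponential moment and the two-sided estimates near the
`|x|^(-1/2)` singularity follow by integrating inequalities for `exp (-(x * s))`; they are collected
in `isCuspKernel_kernel`.

Symmetry comes from moving planes on the equation itself. With `w = oddPart φ a` and `E = evenPart φ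
a`, subtracting the equation at mirror points gives `(c - E) w = K * w`. Since `K (x - y) > K (x +
y)` for distinct `x, y > 0`, a negative minimum of `w` over the half-line forces `c - E ≤ 1`
(`sub_evenPart_le_one`), impossible where `φ` is small; hence the plane can start. The same kernel
inequality is a strong maximum principle: if `w ≥ 0` on the half-line and `w` is not identically
zero there, then `w > 0` and `E < c` (`oddPart_pos_and_evenPart_lt`).

At the last admissible position `a₀`, suppose `w` does not vanish. If `2 φ(a₀) < c`, the plane can
be moved further: negative values of `w` could occur only near the plane or far away, sets of small
kernel mass (`eventually_good`). The borderline case `2 φ(a₀) = c` has no such room near the plane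
and is excluded by `no_asymmetric_cusp`: the even equation bounds `c / 2 - φ` by a multiple of `√x`,
while the odd equation then bounds the odd part below by a multiple of `√x`, and feeding this back
produces a divergent logarithm.

Monotonicity is the strong maximum principle at positions `a < a₀`. Exponential decay is a
comparison with `C exp (-ν|x|)`, where `ν` is chosen from `c` and the kernel alone so that `∫ K exp
(ν|x|) < c` (`exists_decay_rate`). -/

lemma sinh_add_mul_I (a b : ℝ) :
    Complex.sinh (a + b * Complex.I) =
      ((Real.sinh a * Real.cos b : ℝ) : ℂ) + ((Real.cosh a * Real.sin b : ℝ) : ℂ) * Complex.I := by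
  rw [Complex.sinh_add, Complex.cosh_mul_I, Complex.sinh_mul_I]
  push_cast
  ring

lemma cosh_add_mul_I (a b : ℝ) :
    Complex.cosh (a + b * Complex.I) =
      ((Real.cosh a * Real.cos b : ℝ) : ℂ) + ((Real.sinh a * Real.sin b : ℝ) : ℂ) * Complex.I := by
  rw [Complex.cosh_add, Complex.cosh_mul_I, Complex.sinh_mul_I]
  push_cast
  ring

lemma norm_sinh_sq (a b : ℝ) :
    ‖Complex.sinh (a + b * Complex.I)‖ ^ 2 = Real.sinh a ^ 2 + Real.sin b ^ 2 := by
  rw [sinh_add_mul_I, ← Complex.normSq_eq_norm_sq, Complex.normSq_add_mul_I]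
  nlinarith [Real.cosh_sq a, Real.sin_sq_add_cos_sq b]

lemma norm_cosh_sq (a b : ℝ) :
    ‖Complex.cosh (a + b * Complex.I)‖ ^ 2 = Real.sinh a ^ 2 + Real.cos b ^ 2 := by
  rw [cosh_add_mul_I, ← Complex.normSq_eq_norm_sq, Complex.normSq_add_mul_I]
  nlinarith [Real.cosh_sq a, Real.sin_sq_add_cos_sq b]

lemma cosh_ne_zero_of_re_pos {a : ℝ} (ha : 0 < a) (b : ℝ) :
    Complex.cosh (a + b * Complex.I) ≠ 0 := by
  intro h
  have := norm_cosh_sq a b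
  rw [h, norm_zero] at this
  have h1 : 0 < Real.sinh a := Real.sinh_pos_iff.2 ha
  nlinarith [sq_nonneg (Real.cos b)]

lemma norm_tanh_le {a : ℝ} (ha : 0 < a) {b : ℝ} (hb : Real.cos b ≠ 0) :
    ‖Complex.tanh (a + b * Complex.I)‖ ≤ 2 / |Real.cos b| := by
  have hs := norm_sinh_sq a b
  have hc := norm_cosh_sq a b
  have hcp : 0 < ‖Complex.cosh (a + b * Complex.I)‖ := norm_pos_iff.2 (cosh_ne_zero_of_re_pos ha b)
  have hb' : 0 < |Real.cos b| := abs_pos.2 hb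
  have hb1 := Real.abs_cos_le_one b
  rw [Complex.tanh_eq_sinh_div_cosh, norm_div, div_le_div_iff₀ hcp hb']
  refine abs_le_of_sq_le_sq' ?_ (by positivity) |>.2
  rw [mul_pow, mul_pow, hs, hc, sq_abs]
  have h1 : Real.cos b ^ 2 ≤ 1 := Real.cos_sq_le_one b
  have h2 := Real.sin_sq_add_cos_sq b
  nlinarith [sq_nonneg (Real.sinh a), sq_nonneg (Real.cos b), sq_nonneg (Real.sin b),
    mul_nonneg (sq_nonneg (Real.sinh a)) (sub_nonneg.2 h1),
    mul_nonneg (sq_nonneg (Real.cos b)) (sq_nonneg (Real.cos b))]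

lemma norm_tanh_le_of_one_le {a : ℝ} (ha : 1 ≤ a) (b : ℝ) :
    ‖Complex.tanh (a + b * Complex.I)‖ ≤ 2 := by
  have hs := norm_sinh_sq a b
  have hc := norm_cosh_sq a b
  have hcp : 0 < ‖Complex.cosh (a + b * Complex.I)‖ :=
    norm_pos_iff.2 (cosh_ne_zero_of_re_pos (by linarith) b)
  have hsa : 1 < Real.sinh a := lt_of_le_of_lt ha (Real.self_lt_sinh_iff.2 (by linarith))
  rw [Complex.tanh_eq_sinh_div_cosh, norm_div, div_le_iff₀ hcp]
  refine abs_le_of_sq_le_sq' ?_ (by positivity) |>.2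
  rw [mul_pow, hs, hc]
  nlinarith [Real.sin_sq_le_one b, sq_nonneg (Real.cos b)]

/-- The heights `nπ` keep the horizontal edges of the contour away from the poles of `tanh`. -/
lemma norm_tanh_le_one_of_sin_eq_zero {a : ℝ} (ha : 0 < a) {b : ℝ} (hb : Real.sin b = 0) :
    ‖Complex.tanh (a + b * Complex.I)‖ ≤ 1 := by
  have hs := norm_sinh_sq a b
  have hc := norm_cosh_sq a b
  have hcp : 0 < ‖Complex.cosh (a + b * Complex.I)‖ :=
    norm_pos_iff.2 (cosh_ne_zero_of_re_pos ha b)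
  rw [Complex.tanh_eq_sinh_div_cosh, norm_div, div_le_iff₀ hcp, one_mul]
  refine abs_le_of_sq_le_sq' ?_ (by positivity) |>.2
  rw [hs, hc, hb]
  nlinarith [sq_nonneg (Real.cos b)]

/-- The branch of the square root that is continuous on the closed lower half-plane. -/
noncomputable def rotSqrt (w : ℂ) : ℂ :=
  Complex.exp (-(Real.pi / 4 : ℂ) * Complex.I) * (Complex.I * w) ^ (1 / 2 : ℂ)

lemma rotSqrt_sq (w : ℂ) : rotSqrt w ^ 2 = w := by
  have h1 : Complex.exp (-(Real.pi / 4 : ℂ) * Complex.I) ^ 2 = -Complex.I := by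
    rw [← Complex.exp_nat_mul, show ((2 : ℕ) : ℂ) * (-(Real.pi / 4 : ℂ) * Complex.I)
      = -(Real.pi / 2 * Complex.I) by push_cast; ring, Complex.exp_neg, Complex.exp_pi_div_two_mul_I,
      Complex.inv_I]
  have h2 : ((Complex.I * w) ^ (1 / 2 : ℂ)) ^ 2 = Complex.I * w := by
    rw [← Complex.cpow_nat_mul]; simp
  rw [rotSqrt, mul_pow, h1, h2, ← mul_assoc]; simp

lemma norm_rotSqrt_sq (w : ℂ) : ‖rotSqrt w‖ ^ 2 = ‖w‖ := by
  rw [← norm_pow, rotSqrt_sq]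

/-- On negative reals this branch is the limit from the lower half-plane, `-i√|r|`. One formula
covers both signs because `Real.sqrt` vanishes on nonpositive numbers. -/
lemma rotSqrt_ofReal (r : ℝ) :
    rotSqrt r = (Real.sqrt r : ℂ) - Complex.I * (Real.sqrt (-r) : ℂ) := by
  rcases lt_trichotomy r 0 with h | h | h
  · have h1 : Complex.I * (r : ℂ) = ((-r : ℝ) : ℂ) * (-Complex.I) := by push_cast; ring
    have h2 : Real.sqrt r = 0 := Real.sqrt_eq_zero_of_nonpos h.le
    have h3 : ((-r : ℝ) : ℂ) * (-Complex.I) ≠ 0 := by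
      simp [h.ne]
    rw [rotSqrt, h1, Complex.cpow_def_of_ne_zero h3, Complex.log_ofReal_mul (by linarith) (by simp),
      Complex.log_neg_I, ← Complex.exp_add, h2, Real.sqrt_eq_rpow, Real.rpow_def_of_pos (by linarith)]
    rw [show -(Real.pi / 4 : ℂ) * Complex.I +
        (((Real.log (-r) : ℝ) : ℂ) + -((Real.pi : ℂ) / 2) * Complex.I) * (1 / 2) =
        (((Real.log (-r) * (1 / 2) : ℝ)) : ℂ) + -(Real.pi / 2 * Complex.I) by push_cast; ring,
      Complex.exp_add, Complex.exp_neg, Complex.exp_pi_div_two_mul_I, Complex.inv_I]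
    push_cast; ring
  · simp [h, rotSqrt]
  · have h2 : Real.sqrt (-r) = 0 := Real.sqrt_eq_zero_of_nonpos (by linarith)
    have h3 : (r : ℂ) * Complex.I ≠ 0 := by simp [h.ne']
    rw [rotSqrt, mul_comm Complex.I, Complex.cpow_def_of_ne_zero h3,
      Complex.log_ofReal_mul h (by simp),
      Complex.log_I, ← Complex.exp_add, h2, Real.sqrt_eq_rpow, Real.rpow_def_of_pos h]
    rw [show -(Real.pi / 4 : ℂ) * Complex.I +
        (((Real.log r : ℝ) : ℂ) + ((Real.pi : ℂ) / 2) * Complex.I) * (1 / 2) =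
        (((Real.log r * (1 / 2) : ℝ)) : ℂ) by push_cast; ring]
    push_cast; ring

lemma I_mul_mem_slitPlane {w : ℂ} (h : w.im ≤ 0) (h0 : w ≠ 0) :
    Complex.I * w ∈ Complex.slitPlane := by
  rw [Complex.mem_slitPlane_iff]
  simp only [Complex.mul_re, Complex.I_re, Complex.I_im, Complex.mul_im, zero_mul, one_mul, zero_sub,
    zero_add]
  rcases h.lt_or_eq with h | h
  · left; linarith
  · right; intro h'; exact h0 (Complex.ext (by simpa using h') (by simpa using h))

lemma differentiableAt_rotSqrt {w : ℂ} (h : w.im ≤ 0) (h0 : w ≠ 0) :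
    DifferentiableAt ℂ rotSqrt w := by
  unfold rotSqrt
  refine DifferentiableAt.const_mul ?_ _
  exact DifferentiableAt.cpow_const (by fun_prop) (I_mul_mem_slitPlane h h0)

/-- The holomorphic extension of the Whitham symbol to the open right half-plane. -/
noncomputable def symbolExt (z : ℂ) : ℂ := rotSqrt (Complex.tanh z / z)

lemma tanh_div_self_ne_zero {a b : ℝ} (ha : 0 < a) :
    Complex.tanh (a + b * Complex.I) / (a + b * Complex.I) ≠ 0 := by
  have h1 : (a + b * Complex.I : ℂ) ≠ 0 := by
    intro h
    have := congrArg Complex.re h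
    simp at this
    exact ha.ne' this
  have h2 : Complex.sinh (a + b * Complex.I) ≠ 0 := by
    intro h
    have := norm_sinh_sq a b
    rw [h, norm_zero] at this
    have h1 : 0 < Real.sinh a := Real.sinh_pos_iff.2 ha
    nlinarith [sq_nonneg (Real.sin b)]
  rw [Complex.tanh_eq_sinh_div_cosh]
  exact div_ne_zero (div_ne_zero h2 (cosh_ne_zero_of_re_pos ha b)) h1

/-- After multiplication by `|z cosh z|²` the imaginary part is `a sin b cos b - b sinh a cosh a`,
and `sin b cos b ≤ b`, `a ≤ sinh a cosh a`. This is what lets `rotSqrt` be composed holomorphically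
with `tanh z / z`. -/
lemma tanh_div_self_im_nonpos {a b : ℝ} (ha : 0 < a) (hb : 0 ≤ b) :
    (Complex.tanh (a + b * Complex.I) / (a + b * Complex.I)).im ≤ 0 := by
  set z : ℂ := a + b * Complex.I with hz
  have hc : Complex.cosh z ≠ 0 := cosh_ne_zero_of_re_pos ha b
  have hz0 : z ≠ 0 := by
    intro h
    have := congrArg Complex.re h
    simp [hz] at this
    exact ha.ne' this
  have key : Complex.tanh z / z = ((Complex.normSq (Complex.cosh z * z) : ℝ) : ℂ)⁻¹ *
      (Complex.sinh z * (starRingEnd ℂ) (Complex.cosh z * z)) := by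
    rw [Complex.tanh_eq_sinh_div_cosh, div_div, div_eq_mul_inv, Complex.inv_def]
    push_cast
    ring
  rw [key, ← Complex.ofReal_inv, Complex.im_ofReal_mul]
  refine mul_nonpos_of_nonneg_of_nonpos (inv_nonneg.2 (Complex.normSq_nonneg _)) ?_
  have h1 : (Complex.sinh z * (starRingEnd ℂ) (Complex.cosh z * z)).im =
      a * (Real.sin b * Real.cos b) - b * (Real.sinh a * Real.cosh a) := by
    rw [hz, sinh_add_mul_I, cosh_add_mul_I]
    simp only [map_mul, map_add, Complex.conj_ofReal, Complex.conj_I, Complex.mul_im,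
      Complex.mul_re, Complex.add_re, Complex.add_im, Complex.ofReal_re, Complex.ofReal_im,
      Complex.I_re, Complex.I_im, Complex.neg_re, Complex.neg_im]
    ring_nf
    linear_combination (a * Real.sin b * Real.cos b) * Real.cosh_sq a -
      (b * Real.sinh a * Real.cosh a) * Real.sin_sq_add_cos_sq b
  rw [h1]
  have h2 : Real.sin b * Real.cos b ≤ b := by
    have := Real.sin_le (show 0 ≤ 2 * b by linarith)
    rw [Real.sin_two_mul] at this
    linarith
  have h3 : a ≤ Real.sinh a * Real.cosh a := by
    have h4 : a < Real.sinh a := Real.self_lt_sinh_iff.2 ha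
    nlinarith [Real.one_le_cosh a]
  nlinarith [mul_le_mul_of_nonneg_left h2 ha.le, mul_le_mul_of_nonneg_left h3 hb]

lemma differentiableAt_tanh {z : ℂ} (h : Complex.cosh z ≠ 0) :
    DifferentiableAt ℂ Complex.tanh z := by
  have : Complex.tanh = fun z => Complex.sinh z / Complex.cosh z :=
    funext Complex.tanh_eq_sinh_div_cosh
  rw [this]
  exact (Complex.differentiable_sinh z).div (Complex.differentiable_cosh z) h

lemma differentiableAt_symbolExt {z : ℂ} (ha : 0 < z.re) (hb : 0 ≤ z.im) :
    DifferentiableAt ℂ symbolExt z := by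
  have hz : z = z.re + z.im * Complex.I := (Complex.re_add_im z).symm
  have hz0 : z ≠ 0 := by rintro rfl; simp at ha
  have h1 : DifferentiableAt ℂ (fun z => Complex.tanh z / z) z := by
    refine (differentiableAt_tanh ?_).div differentiableAt_id hz0
    rw [hz]; exact cosh_ne_zero_of_re_pos ha _
  have h2 : DifferentiableAt ℂ rotSqrt (Complex.tanh z / z) := by
    rw [hz]
    exact differentiableAt_rotSqrt (tanh_div_self_im_nonpos ha hb) (tanh_div_self_ne_zero ha)
  exact DifferentiableAt.comp (f := fun z => Complex.tanh z / z) z h2 h1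

lemma tanh_mul_I_div (s : ℝ) :
    Complex.tanh (s * Complex.I) / (s * Complex.I) = ((Real.tan s / s : ℝ) : ℂ) := by
  rw [Complex.tanh_mul_I]
  push_cast
  rw [mul_div_mul_right _ _ Complex.I_ne_zero]

lemma symbolExt_mul_I (s : ℝ) :
    symbolExt (s * Complex.I) =
      (Real.sqrt (Real.tan s / s) : ℂ) - Complex.I * (Real.sqrt (-(Real.tan s) / s) : ℂ) := by
  rw [symbolExt, tanh_mul_I_div s, rotSqrt_ofReal, neg_div]

lemma continuousAt_symbolExt_mul_I {s : ℝ} (hs : s ≠ 0) (hsin : Real.sin s ≠ 0)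
    (hcos : Real.cos s ≠ 0) : ContinuousAt symbolExt (s * Complex.I) := by
  have h1 : ContinuousAt (fun z => Complex.tanh z / z) (s * Complex.I) := by
    refine ((differentiableAt_tanh ?_).div differentiableAt_id ?_).continuousAt
    · rw [Complex.cosh_mul_I]; exact_mod_cast hcos
    · simp [hs]
  have h2 : ContinuousAt rotSqrt (Complex.tanh (s * Complex.I) / (s * Complex.I)) := by
    rw [tanh_mul_I_div s]
    refine (differentiableAt_rotSqrt (by simp) ?_).continuousAt
    have : Real.tan s / s ≠ 0 := div_ne_zero (by
      rw [Real.tan_eq_sin_div_cos]; exact div_ne_zero hsin hcos) hs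
    exact_mod_cast this
  exact ContinuousAt.comp (f := fun z => Complex.tanh z / z) h2 h1

lemma tanh_pos {t : ℝ} (ht : 0 < t) : 0 < Real.tanh t := by
  rw [Real.tanh_eq_sinh_div_cosh]
  exact div_pos (Real.sinh_pos_iff.2 ht) (Real.cosh_pos t)

lemma symbolExt_ofReal {t : ℝ} (ht : 0 < t) : symbolExt t = (symbol t : ℂ) := by
  have h : Complex.tanh (t : ℂ) / (t : ℂ) = ((Real.tanh t / t : ℝ) : ℂ) := by push_cast; rfl
  have h0 : 0 < Real.tanh t / t := div_pos (tanh_pos ht) ht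
  rw [symbolExt, h, rotSqrt_ofReal, symbol, if_neg ht.ne',
    Real.sqrt_eq_zero_of_nonpos (show -(Real.tanh t / t) ≤ 0 by linarith)]
  simp

lemma norm_symbolExt_sq (z : ℂ) : ‖symbolExt z‖ ^ 2 = ‖Complex.tanh z‖ / ‖z‖ := by
  rw [symbolExt, norm_rotSqrt_sq, norm_div]

lemma norm_symbolExt_le {a s : ℝ} (ha : 0 < a) (hs : 0 < s) (hc : Real.cos s ≠ 0) :
    ‖symbolExt (a + s * Complex.I)‖ ≤ Real.sqrt (2 / (|Real.cos s| * s)) := by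
  refine Real.le_sqrt_of_sq_le ?_
  have hz : s ≤ ‖(a + s * Complex.I : ℂ)‖ := by
    have := Complex.abs_im_le_norm (a + s * Complex.I : ℂ)
    simp at this
    exact (le_abs_self s).trans this
  rw [norm_symbolExt_sq, ← div_div]
  have := abs_pos.2 hc
  exact div_le_div₀ (by positivity) (norm_tanh_le ha hc) hs hz

lemma norm_symbolExt_le_of_one_le {a : ℝ} (ha : 1 ≤ a) (s : ℝ) :
    ‖symbolExt (a + s * Complex.I)‖ ≤ Real.sqrt (2 / a) := by
  refine Real.le_sqrt_of_sq_le ?_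
  have hz : a ≤ ‖(a + s * Complex.I : ℂ)‖ := by
    have := Complex.abs_re_le_norm (a + s * Complex.I : ℂ)
    simp at this
    exact (le_abs_self a).trans this
  rw [norm_symbolExt_sq]
  exact div_le_div₀ (by positivity) (norm_tanh_le_of_one_le ha s) (by linarith) hz

lemma norm_symbolExt_le_one {a s : ℝ} (ha : 0 < a) (hs : 1 ≤ s) (hsin : Real.sin s = 0) :
    ‖symbolExt (a + s * Complex.I)‖ ≤ 1 := by
  have hz : 1 ≤ ‖(a + s * Complex.I : ℂ)‖ := by
    have := Complex.abs_im_le_norm (a + s * Complex.I : ℂ)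
    simp at this
    exact (hs.trans (le_abs_self s)).trans this
  have h : ‖symbolExt (a + s * Complex.I)‖ ^ 2 ≤ 1 := by
    rw [norm_symbolExt_sq]
    exact div_le_one_of_le₀ ((norm_tanh_le_one_of_sin_eq_zero ha hsin).trans hz) (norm_nonneg _)
  exact (sq_le_one_iff₀ (norm_nonneg _)).1 h

/-! ### The dominating function on the imaginary axis -/

lemma intervalIntegrable_inv_sqrt_abs_sin :
    IntervalIntegrable (fun s : ℝ => (Real.sqrt |Real.sin s|)⁻¹) volume 0 (Real.pi / 2) := by
  have h1 : IntervalIntegrable (fun s : ℝ => Real.sqrt (Real.pi / 2) * s ^ (-(1 / 2) : ℝ)) volume 0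
      (Real.pi / 2) :=
    (intervalIntegral.intervalIntegrable_rpow' (by norm_num)).const_mul _
  refine h1.mono_fun (Measurable.aestronglyMeasurable (by fun_prop)) ?_
  rw [uIoc_of_le (by positivity)]
  refine (ae_restrict_iff' measurableSet_Ioc).2 (Eventually.of_forall fun s hs => ?_)
  have hs0 : 0 < s := hs.1
  have hsin : 2 / Real.pi * s ≤ Real.sin s := Real.mul_le_sin hs0.le hs.2
  have hpos : 0 < 2 / Real.pi * s := by positivity
  beta_reduce
  rw [Real.norm_of_nonneg (by positivity), Real.norm_of_nonneg (by positivity),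
    abs_of_pos (hpos.trans_le hsin), Real.rpow_neg hs0.le, ← Real.sqrt_eq_rpow]
  calc (Real.sqrt (Real.sin s))⁻¹ ≤ (Real.sqrt (2 / Real.pi * s))⁻¹ :=
        inv_anti₀ (Real.sqrt_pos.2 hpos) (Real.sqrt_le_sqrt hsin)
    _ = Real.sqrt (Real.pi / 2) * (Real.sqrt s)⁻¹ := by
        rw [Real.sqrt_mul (by positivity), mul_inv, ← Real.sqrt_inv, inv_div]

lemma periodic_inv_sqrt_abs_cos :
    Function.Periodic (fun s : ℝ => (Real.sqrt |Real.cos s|)⁻¹) Real.pi := by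
  intro s
  simp [Real.cos_add_pi]

lemma intervalIntegrable_inv_sqrt_abs_cos (a b : ℝ) :
    IntervalIntegrable (fun s : ℝ => (Real.sqrt |Real.cos s|)⁻¹) volume a b := by
  have h1 := intervalIntegrable_inv_sqrt_abs_sin.comp_sub_left (Real.pi / 2)
  have h2 := intervalIntegrable_inv_sqrt_abs_sin.comp_sub_right (Real.pi / 2)
  simp only [Real.sin_pi_div_two_sub, sub_zero, sub_self] at h1
  simp only [Real.sin_sub_pi_div_two, abs_neg, zero_add, add_halves] at h2
  exact periodic_inv_sqrt_abs_cos.intervalIntegrable₀ Real.pi_ne_zero (h1.symm.trans h2) a b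

/-- The dominating function for `symbolExt` along vertical lines. -/
noncomputable def dominator (s : ℝ) : ℝ := Real.sqrt (2 / (|Real.cos s| * s)) / (1 + s)

lemma dominator_eq {s : ℝ} : dominator s =
    Real.sqrt 2 * ((Real.sqrt |Real.cos s|)⁻¹ * ((Real.sqrt s)⁻¹ / (1 + s))) := by
  rw [dominator, Real.sqrt_div (by norm_num), Real.sqrt_mul (abs_nonneg _)]
  ring

lemma measurable_dominator : Measurable dominator := by
  unfold dominator; fun_prop

lemma integrableOn_dominator_Ioc_zero_one : IntegrableOn dominator (Ioc 0 1) := by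
  have h1 : IntervalIntegrable (fun s : ℝ => 2 * s ^ (-(1 / 2) : ℝ)) volume 0 1 :=
    (intervalIntegral.intervalIntegrable_rpow' (by norm_num)).const_mul _
  rw [intervalIntegrable_iff_integrableOn_Ioc_of_le zero_le_one] at h1
  refine Integrable.mono h1 measurable_dominator.aestronglyMeasurable ?_
  refine (ae_restrict_iff' measurableSet_Ioc).2 (Eventually.of_forall fun s hs => ?_)
  have hs0 : 0 < s := hs.1
  have hc : 1 / 2 < Real.cos s := by
    rw [← Real.cos_pi_div_three]
    exact Real.cos_lt_cos_of_nonneg_of_le_pi_div_two hs0.le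
      (by linarith [Real.pi_pos]) (by linarith [Real.pi_gt_three, hs.2])
  rw [Real.norm_of_nonneg (by unfold dominator; positivity), Real.norm_of_nonneg (by positivity),
    Real.rpow_neg hs0.le, ← Real.sqrt_eq_rpow, dominator, abs_of_pos (by linarith)]
  calc Real.sqrt (2 / (Real.cos s * s)) / (1 + s) ≤ Real.sqrt (2 / (Real.cos s * s)) :=
        div_le_self (Real.sqrt_nonneg _) (by linarith)
    _ ≤ Real.sqrt (2 ^ 2 / s) := by
        refine Real.sqrt_le_sqrt ?_
        rw [div_le_div_iff₀ (by positivity) hs0]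
        nlinarith
    _ = 2 * (Real.sqrt s)⁻¹ := by
        rw [Real.sqrt_div (by norm_num), Real.sqrt_sq (by norm_num)]; rfl

lemma intervalIntegrable_dominator {a b : ℝ} (ha : 1 ≤ a) (hab : a ≤ b) :
    IntervalIntegrable dominator volume a b := by
  refine (((intervalIntegrable_inv_sqrt_abs_cos a b).const_mul (Real.sqrt 2))).mono_fun
    measurable_dominator.aestronglyMeasurable ?_
  rw [uIoc_of_le hab]
  refine (ae_restrict_iff' measurableSet_Ioc).2 (Eventually.of_forall fun s hs => ?_)
  have hs1 : 1 ≤ s := ha.trans hs.1.le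
  beta_reduce
  rw [dominator_eq, Real.norm_of_nonneg (by positivity), Real.norm_of_nonneg (by positivity),
    ← mul_assoc]
  refine mul_le_of_le_one_right (by positivity) ?_
  rw [div_le_one (by positivity)]
  exact (inv_le_one_of_one_le₀ (Real.one_le_sqrt.2 hs1)).trans (by linarith)

/-- The zeros of `cos` give integrable inverse-square-root singularities, whose mass over one period
is a fixed `A`. The remaining factor is at most `(k + 1)^(-3/2)` on the period starting at `(k +
1)π`, so the masses are summable. -/
lemma integrableOn_dominator : IntegrableOn dominator (Ioi 0) := by
  have hpi := Real.pi_gt_three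
  have h0 : IntegrableOn dominator (Ioc 0 Real.pi) := by
    rw [← Ioc_union_Ioc_eq_Ioc zero_le_one (by linarith)]
    refine integrableOn_dominator_Ioc_zero_one.union ?_
    exact (intervalIntegrable_iff_integrableOn_Ioc_of_le (by linarith)).1
      (intervalIntegrable_dominator le_rfl (by linarith))
  set A : ℝ := ∫ s in (0 : ℝ)..Real.pi, (Real.sqrt |Real.cos s|)⁻¹ with hA
  have hsum : Summable fun k : ℕ => Real.sqrt 2 * A * ((k : ℝ) + 1) ^ (-(3 / 2) : ℝ) := by
    refine Summable.mul_left _ ?_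
    have := (Real.summable_nat_rpow (p := -(3/2))).2 (by norm_num)
    exact_mod_cast (summable_nat_add_iff 1).2 this
  have h1 : IntegrableOn dominator (Ioi Real.pi) := by
    refine integrableOn_Ioi_of_intervalIntegral_norm_bounded (l := atTop)
      (b := fun n : ℕ => ((n : ℝ) + 1) * Real.pi)
      (∑' k : ℕ, Real.sqrt 2 * A * ((k : ℝ) + 1) ^ (-(3 / 2) : ℝ)) Real.pi ?_ ?_ ?_
    · intro n
      refine (intervalIntegrable_iff_integrableOn_Ioc_of_le ?_).1
        (intervalIntegrable_dominator (by linarith) ?_) <;> nlinarith [(n.cast_nonneg : (0 : ℝ) ≤ n)]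
    · exact (tendsto_natCast_atTop_atTop.atTop_add tendsto_const_nhds).atTop_mul_const Real.pi_pos
    · refine Eventually.of_forall fun n => ?_
      have hi : ∀ k : ℕ, IntervalIntegrable dominator volume (((k : ℝ) + 1) * Real.pi)
          (((k + 1 : ℕ) + 1) * Real.pi) := fun k =>
        intervalIntegrable_dominator (by nlinarith [(k.cast_nonneg : (0 : ℝ) ≤ k)])
          (by push_cast; nlinarith)
      have h2 := intervalIntegral.sum_integral_adjacent_intervals (μ := volume)
        (f := fun s => ‖dominator s‖) (a := fun k : ℕ => ((k : ℝ) + 1) * Real.pi) (n := n)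
        (fun k _ => (hi k).norm)
      simp only [Nat.cast_zero, zero_add, one_mul] at h2
      rw [← h2]
      refine le_trans (Finset.sum_le_sum fun k _ => ?_) (hsum.sum_le_tsum _ fun k _ => ?_)
      · have hk : (0 : ℝ) ≤ k := k.cast_nonneg
        have h3 : ∫ s in ((k : ℝ) + 1) * Real.pi..((k + 1 : ℕ) + 1) * Real.pi,
            (Real.sqrt |Real.cos s|)⁻¹ = A := by
          have := periodic_inv_sqrt_abs_cos.intervalIntegral_add_eq (((k : ℝ) + 1) * Real.pi) 0
          rw [zero_add] at this
          rw [hA, ← this]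
          congr 1; push_cast; ring
        rw [mul_right_comm, mul_comm _ A, ← h3, ← intervalIntegral.integral_mul_const]
        refine intervalIntegral.integral_mono_on (by push_cast; nlinarith) (hi k).norm
          ((intervalIntegrable_inv_sqrt_abs_cos _ _).mul_const _) fun s hs => ?_
        have hs1 : (k : ℝ) + 1 ≤ s := le_trans (by nlinarith) hs.1
        have hs0 : 0 < s := by linarith
        rw [Real.norm_of_nonneg (by unfold dominator; positivity), dominator_eq,
          mul_comm (Real.sqrt 2), mul_assoc]
        refine mul_le_mul_of_nonneg_left ?_ (by positivity)
        rw [mul_comm]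
        refine mul_le_mul_of_nonneg_left ?_ (by positivity)
        calc (Real.sqrt s)⁻¹ / (1 + s) ≤ (Real.sqrt s)⁻¹ / s := by
              gcongr; linarith
          _ = s ^ (-(3 / 2) : ℝ) := by
              rw [Real.sqrt_eq_rpow, ← Real.rpow_neg hs0.le, div_eq_mul_inv, ← Real.rpow_neg_one s,
                ← Real.rpow_add hs0]; norm_num
          _ ≤ _ := Real.rpow_le_rpow_of_nonpos (by positivity) hs1 (by norm_num)
      · have : 0 ≤ A := intervalIntegral.integral_nonneg Real.pi_pos.le fun s _ => by positivity
        positivity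
  rw [← Ioc_union_Ioi_eq_Ioi Real.pi_pos.le]
  exact h0.union h1

/-! ### Rotation of the contour from the real to the imaginary axis -/

/-- The functions against which the contour of integration can be rotated. -/
structure IsContourWeight (C : ℝ) (h : ℂ → ℂ) : Prop where
  differentiableAt : ∀ z : ℂ, 0 ≤ z.re → 0 ≤ z.im → DifferentiableAt ℂ h z
  norm_le : ∀ z : ℂ, 0 ≤ z.re → 0 ≤ z.im → ‖h z‖ ≤ C / (1 + z.im)

/-- The boundary values of `symbolExt` on the positive imaginary axis. -/
noncomputable def boundaryValue (s : ℝ) : ℂ :=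
  (Real.sqrt (Real.tan s / s) : ℂ) - Complex.I * (Real.sqrt (-(Real.tan s) / s) : ℂ)

lemma ae_cos_ne_zero : ∀ᵐ s : ℝ, Real.cos s ≠ 0 := by
  rw [ae_iff]
  simp only [not_not]
  refine (Countable.mono ?_ (countable_range fun k : ℤ => (2 * k + 1) * Real.pi / 2)).measure_zero _
  intro s hs
  obtain ⟨k, hk⟩ := Real.cos_eq_zero_iff.1 hs
  exact ⟨k, hk.symm⟩

lemma ae_sin_ne_zero : ∀ᵐ s : ℝ, Real.sin s ≠ 0 := by
  rw [ae_iff]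
  simp only [not_not]
  refine (Countable.mono ?_ (countable_range fun k : ℤ => k * Real.pi)).measure_zero _
  intro s hs
  obtain ⟨k, hk⟩ := Real.sin_eq_zero_iff.1 hs
  exact ⟨k, hk⟩

section
variable {C : ℝ} {h : ℂ → ℂ} (hh : IsContourWeight C h)
include hh

lemma IsContourWeight.norm_mul_le {a s : ℝ} (ha : 0 < a) (hs : 0 < s) (hc : Real.cos s ≠ 0) :
    ‖symbolExt (a + s * Complex.I) * h (a + s * Complex.I)‖ ≤ C * dominator s := by
  have h1 := norm_symbolExt_le ha hs hc
  have h2 := hh.norm_le (a + s * Complex.I) (by simp [ha.le]) (by simp [hs.le])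
  simp only [Complex.add_im, Complex.ofReal_im, Complex.mul_im, Complex.ofReal_re, Complex.I_im,
    mul_one, Complex.I_re, mul_zero, add_zero, zero_add] at h2
  rw [norm_mul, dominator, mul_div_left_comm]
  exact mul_le_mul h1 h2 (norm_nonneg _) (Real.sqrt_nonneg _)

lemma IsContourWeight.continuousOn_vertical {a : ℝ} (ha : 0 < a) :
    ContinuousOn (fun s : ℝ => symbolExt (a + s * Complex.I) * h (a + s * Complex.I)) (Ici 0) := by
  intro s hs
  have hz : DifferentiableAt ℂ (fun z => symbolExt z * h z) (a + s * Complex.I) :=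
    (differentiableAt_symbolExt (by simpa using ha) (by simpa using hs)).mul
      (hh.differentiableAt _ (by simpa using ha.le) (by simpa using hs))
  exact (ContinuousAt.comp (f := fun s : ℝ => (a + s * Complex.I : ℂ)) hz.continuousAt
    (by fun_prop)).continuousWithinAt

lemma IsContourWeight.integrableOn_vertical {a : ℝ} (ha : 0 < a) :
    IntegrableOn (fun s : ℝ => symbolExt (a + s * Complex.I) * h (a + s * Complex.I)) (Ioi 0) := by
  refine Integrable.mono' (integrableOn_dominator.const_mul C)
    (((hh.continuousOn_vertical ha).mono Ioi_subset_Ici_self).aestronglyMeasurable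
      measurableSet_Ioi) ?_
  filter_upwards [ae_restrict_mem measurableSet_Ioi, ae_restrict_of_ae ae_cos_ne_zero] with s hs hc
  exact hh.norm_mul_le ha hs hc

lemma IsContourWeight.rectangle {ε R : ℝ} (hε : 0 < ε) (hR : ε ≤ R) {H : ℝ} (hH : 0 ≤ H) :
    (∫ t in ε..R, symbolExt t * h t) -
      (∫ t in ε..R, symbolExt (t + H * Complex.I) * h (t + H * Complex.I)) +
      Complex.I * (∫ s in (0 : ℝ)..H, symbolExt (R + s * Complex.I) * h (R + s * Complex.I)) -
      Complex.I * (∫ s in (0 : ℝ)..H, symbolExt (ε + s * Complex.I) * h (ε + s * Complex.I)) = 0 := by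
  have h1 := Complex.integral_boundary_rect_eq_zero_of_differentiableOn
    (fun z => symbolExt z * h z) (ε : ℂ) (R + H * Complex.I) ?_
  · simpa using h1
  · intro z hz
    have hz1 : z.re ∈ uIcc ε R := by simpa using hz.1
    have hz2 : z.im ∈ uIcc 0 H := by simpa using hz.2
    rw [uIcc_of_le hR] at hz1
    rw [uIcc_of_le hH] at hz2
    exact ((differentiableAt_symbolExt (hε.trans_le hz1.1) hz2.1).mul
      (hh.differentiableAt _ (hε.le.trans hz1.1) hz2.1)).differentiableWithinAt

lemma IsContourWeight.const_nonneg : 0 ≤ C := by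
  have := (norm_nonneg _).trans (hh.norm_le 0 (by simp) (by simp))
  simpa using this

/-- Rectangles of height `nπ` are used: on their top edges `symbolExt` has norm at most 1 and the
weight is `O(1/n)`, so these edges drop out in the limit. -/
lemma IsContourWeight.strip {ε R : ℝ} (hε : 0 < ε) (hR : ε ≤ R) :
    (∫ t in ε..R, symbolExt t * h t) =
      Complex.I * (∫ s in Ioi (0 : ℝ), symbolExt (ε + s * Complex.I) * h (ε + s * Complex.I)) -
      Complex.I * (∫ s in Ioi (0 : ℝ), symbolExt (R + s * Complex.I) * h (R + s * Complex.I)) := by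
  have hb : Tendsto (fun n : ℕ => (n : ℝ) * Real.pi) atTop atTop :=
    tendsto_natCast_atTop_atTop.atTop_mul_const Real.pi_pos
  have h1 := intervalIntegral_tendsto_integral_Ioi 0 (hh.integrableOn_vertical hε) hb
  have h2 := intervalIntegral_tendsto_integral_Ioi 0 (hh.integrableOn_vertical (hε.trans_le hR)) hb
  have h3 : Tendsto (fun n : ℕ => ∫ t in ε..R, symbolExt (t + ((n * Real.pi : ℝ) : ℂ) * Complex.I) *
      h (t + ((n * Real.pi : ℝ) : ℂ) * Complex.I)) atTop (𝓝 0) := by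
    have hlim : Tendsto (fun n : ℕ => C / (1 + (n : ℝ) * Real.pi) * |R - ε|) atTop (𝓝 0) := by
      have := (tendsto_const_nhds (x := C)).div_atTop (tendsto_atTop_add_const_left _ 1 hb)
      simpa using this.mul_const |R - ε|
    refine squeeze_zero_norm' ?_ hlim
    filter_upwards [eventually_ge_atTop 1] with n hn
    refine intervalIntegral.norm_integral_le_of_norm_le_const fun t ht => ?_
    rw [uIoc_of_le hR] at ht
    have ht0 : 0 < t := hε.trans ht.1
    have hn1 : (1 : ℝ) ≤ n * Real.pi := by
      have : (1 : ℝ) ≤ n := by exact_mod_cast hn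
      nlinarith [Real.pi_gt_three]
    have h4 := norm_symbolExt_le_one ht0 hn1 (Real.sin_nat_mul_pi n)
    have h5 := hh.norm_le (t + ((n * Real.pi : ℝ) : ℂ) * Complex.I) (by simpa using ht0.le)
      (by simpa using by positivity)
    rw [norm_mul]
    refine (mul_le_mul h4 h5 (norm_nonneg _) zero_le_one).trans_eq ?_
    simp
  have h4 := ((tendsto_const_nhds (x := ∫ t in ε..R, symbolExt t * h t)).sub h3).add
    (h2.const_mul Complex.I) |>.sub (h1.const_mul Complex.I)
  have h5 := tendsto_nhds_unique h4 (tendsto_const_nhds.congr fun n : ℕ =>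
    (hh.rectangle hε hR (H := n * Real.pi) (by positivity)).symm)
  linear_combination h5

lemma IsContourWeight.tendsto_vertical_zero :
    Tendsto (fun ε : ℝ => ∫ s in Ioi (0 : ℝ), symbolExt (ε + s * Complex.I) * h (ε + s * Complex.I))
      (𝓝[>] 0) (𝓝 (∫ s in Ioi (0 : ℝ), boundaryValue s * h (s * Complex.I))) := by
  refine tendsto_integral_filter_of_dominated_convergence (fun s => C * dominator s) ?_ ?_
    (integrableOn_dominator.const_mul C) ?_
  · filter_upwards [self_mem_nhdsWithin] with ε hε
    exact (hh.integrableOn_vertical hε).aestronglyMeasurable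
  · filter_upwards [self_mem_nhdsWithin] with ε hε
    filter_upwards [ae_restrict_mem measurableSet_Ioi, ae_restrict_of_ae ae_cos_ne_zero]
      with s hs hc
    exact hh.norm_mul_le hε hs hc
  · filter_upwards [ae_restrict_mem measurableSet_Ioi, ae_restrict_of_ae ae_cos_ne_zero,
      ae_restrict_of_ae ae_sin_ne_zero] with s hs hc hsin
    have hs0 : (0 : ℝ) < s := hs
    have h1 : ContinuousAt (fun z => symbolExt z * h z) (s * Complex.I) :=
      (continuousAt_symbolExt_mul_I hs0.ne' hsin hc).mul
        (hh.differentiableAt _ (by simp) (by simpa using hs0.le)).continuousAt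
    rw [boundaryValue, ← symbolExt_mul_I s]
    have h2 : Tendsto (fun ε : ℝ => (ε + s * Complex.I : ℂ)) (𝓝[>] 0) (𝓝 (s * Complex.I)) := by
      have : Tendsto (fun ε : ℝ => (ε + s * Complex.I : ℂ)) (𝓝 0) (𝓝 (((0 : ℝ) : ℂ) + s * Complex.I)) :=
        Continuous.tendsto (by fun_prop) 0
      simpa using this.mono_left nhdsWithin_le_nhds
    exact h1.tendsto.comp h2

lemma IsContourWeight.tendsto_vertical_atTop :
    Tendsto (fun R : ℝ => ∫ s in Ioi (0 : ℝ), symbolExt (R + s * Complex.I) * h (R + s * Complex.I))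
      atTop (𝓝 0) := by
  have : (0 : ℂ) = ∫ s in Ioi (0 : ℝ), (0 : ℂ) := by simp
  rw [this]
  refine tendsto_integral_filter_of_dominated_convergence (fun s => C * dominator s) ?_ ?_
    (integrableOn_dominator.const_mul C) ?_
  · filter_upwards [eventually_gt_atTop 0] with ε hε
    exact (hh.integrableOn_vertical hε).aestronglyMeasurable
  · filter_upwards [eventually_gt_atTop 0] with ε hε
    filter_upwards [ae_restrict_mem measurableSet_Ioi, ae_restrict_of_ae ae_cos_ne_zero]
      with s hs hc
    exact hh.norm_mul_le hε hs hc
  · filter_upwards [ae_restrict_mem measurableSet_Ioi] with s hs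
    have hs0 : (0 : ℝ) < s := hs
    have hlim : Tendsto (fun R : ℝ => Real.sqrt (2 / R) * C) atTop (𝓝 0) := by
      have h1 : Tendsto (fun R : ℝ => 2 / R) atTop (𝓝 0) :=
        tendsto_const_nhds.div_atTop tendsto_id
      have h2 := (Real.continuous_sqrt.tendsto 0).comp h1
      simp only [Real.sqrt_zero] at h2
      simpa using h2.mul_const C
    refine squeeze_zero_norm' ?_ hlim
    filter_upwards [eventually_ge_atTop 1] with R hR
    rw [norm_mul]
    refine mul_le_mul (norm_symbolExt_le_of_one_le hR s) ?_ (norm_nonneg _) (Real.sqrt_nonneg _)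
    refine (hh.norm_le _ (by simpa using by linarith) (by simpa using hs0.le)).trans ?_
    exact div_le_self hh.const_nonneg (by simpa using hs0.le)

end

/-! ### Elementary bounds on the symbol and the rotated integral. -/

lemma symbol_nonneg (t : ℝ) : 0 ≤ symbol t := by
  unfold symbol; split_ifs <;> positivity

lemma symbol_neg (t : ℝ) : symbol (-t) = symbol t := by
  simp [symbol, Real.tanh_neg]

lemma symbol_le_one (t : ℝ) : symbol t ≤ 1 := by
  have key : ∀ t : ℝ, 0 < t → symbol t ≤ 1 := by
    intro t ht
    rw [symbol, if_neg ht.ne', Real.sqrt_le_one, div_le_one ht, Real.tanh_eq_sinh_div_cosh,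
      div_le_iff₀ (Real.cosh_pos t)]
    have h1 := (convex_Icc 0 t).norm_image_sub_le_of_norm_deriv_le (f := Real.sinh)
      (C := Real.cosh t) (fun x _ => Real.differentiable_sinh x) (fun x hx => by
        rw [Real.deriv_sinh, Real.norm_of_nonneg (Real.cosh_pos x).le, Real.cosh_le_cosh,
          abs_of_nonneg hx.1, abs_of_pos ht]
        exact hx.2) (left_mem_Icc.2 ht.le) (right_mem_Icc.2 ht.le)
    rw [Real.sinh_zero, sub_zero, sub_zero, Real.norm_of_nonneg ht.le, mul_comm] at h1
    exact (le_abs_self _).trans h1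
  rcases lt_trichotomy t 0 with h | h | h
  · rw [← symbol_neg]; exact key _ (by linarith)
  · simp [symbol, h]
  · exact key t h

lemma symbol_le_inv_sqrt {t : ℝ} (ht : 0 < t) : symbol t ≤ (Real.sqrt t)⁻¹ := by
  rw [symbol, if_neg ht.ne', ← Real.sqrt_inv, ← one_div]
  exact Real.sqrt_le_sqrt (div_le_div_of_nonneg_right (Real.tanh_lt_one t).le ht.le)

lemma measurable_symbol : Measurable symbol := by
  unfold symbol
  refine Measurable.ite (measurableSet_singleton 0) measurable_const ?_
  have : Measurable Real.tanh := by
    have : Real.tanh = fun x => Real.sinh x / Real.cosh x := funext Real.tanh_eq_sinh_div_cosh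
    rw [this]
    exact Real.measurable_sinh.div Real.measurable_cosh
  fun_prop

lemma intervalIntegrable_symbol_mul {h : ℝ → ℂ} (hc : Continuous h) (a b : ℝ) :
    IntervalIntegrable (fun t => (symbol t : ℂ) * h t) volume a b := by
  refine (hc.intervalIntegrable a b).mono_fun
    ((Complex.measurable_ofReal.comp measurable_symbol).mul hc.measurable).aestronglyMeasurable
    (Eventually.of_forall fun t => ?_)
  beta_reduce
  rw [norm_mul, Complex.norm_real, Real.norm_of_nonneg (symbol_nonneg t)]
  exact mul_le_of_le_one_left (norm_nonneg _) (symbol_le_one t)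

/-- Rotation of the contour of integration. -/
theorem IsContourWeight.tendsto_integral {C : ℝ} {h : ℂ → ℂ} (hh : IsContourWeight C h)
    (hc : Continuous fun t : ℝ => h t) :
    Tendsto (fun R : ℝ => ∫ t in (0 : ℝ)..R, (symbol t : ℂ) * h t) atTop
      (𝓝 (Complex.I * ∫ s in Ioi (0 : ℝ), boundaryValue s * h (s * Complex.I))) := by
  set V : ℝ → ℂ := fun R => ∫ s in Ioi (0 : ℝ), symbolExt (R + s * Complex.I) * h (R + s * Complex.I)
    with hV
  set V0 : ℂ := ∫ s in Ioi (0 : ℝ), boundaryValue s * h (s * Complex.I) with hV0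
  have h1 : ∀ R : ℝ, 0 < R → ∫ t in (0 : ℝ)..R, (symbol t : ℂ) * h t
      = Complex.I * V0 - Complex.I * V R := by
    intro R hR
    -- The contour identity is available only for `Re z > 0`, so the lower endpoint is first kept at
    -- `ε`.
    have h2 : ∀ᶠ ε in 𝓝[>] (0 : ℝ), ∫ t in ε..R, (symbol t : ℂ) * h t =
        Complex.I * V ε - Complex.I * V R := by
      filter_upwards [self_mem_nhdsWithin, nhdsWithin_le_nhds (Iio_mem_nhds hR)] with ε hε hεR
      rw [← hh.strip hε (le_of_lt hεR)]
      refine intervalIntegral.integral_congr fun t ht => ?_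
      rw [uIcc_of_le (le_of_lt hεR)] at ht
      rw [symbolExt_ofReal (lt_of_lt_of_le hε ht.1)]
    have h3 : Tendsto (fun ε => ∫ t in ε..R, (symbol t : ℂ) * h t) (𝓝[>] 0)
        (𝓝 (∫ t in (0 : ℝ)..R, (symbol t : ℂ) * h t)) := by
      have := (intervalIntegral.continuous_primitive
        (fun a b => intervalIntegrable_symbol_mul hc a b) R).tendsto 0
      have h4 := (this.mono_left (nhdsWithin_le_nhds (s := Ioi 0))).neg
      simp only [← intervalIntegral.integral_symm] at h4
      exact h4
    exact tendsto_nhds_unique (h3.congr' h2) ((hh.tendsto_vertical_zero.const_mul _).sub_const _)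
  have h2 := (hh.tendsto_vertical_atTop.const_mul Complex.I).const_sub (Complex.I * V0)
  rw [mul_zero, sub_zero] at h2
  refine h2.congr' ?_
  filter_upwards [eventually_gt_atTop 0] with R hR
  exact (h1 R hR).symm

/-! ### The Whitham kernel as a Laplace transform -/

/-- The density (up to the factor `π`) of the representing measure of the Whitham kernel. -/
noncomputable def density (s : ℝ) : ℝ := Real.sqrt (-(Real.tan s) / s)

lemma density_nonneg (s : ℝ) : 0 ≤ density s := Real.sqrt_nonneg _

lemma measurable_tan : Measurable Real.tan := by
  have : Real.tan = fun x => Real.sin x / Real.cos x := funext Real.tan_eq_sin_div_cos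
  rw [this]
  exact Real.measurable_sin.div Real.measurable_cos

lemma measurable_density : Measurable density :=
  Real.continuous_sqrt.measurable.comp (measurable_tan.neg.div measurable_id)

lemma density_eq_zero {s : ℝ} (h0 : 0 < s) (h1 : s < Real.pi / 2) : density s = 0 := by
  refine Real.sqrt_eq_zero_of_nonpos ?_
  have := Real.tan_pos_of_pos_of_lt_pi_div_two h0 h1
  exact div_nonpos_of_nonpos_of_nonneg (by linarith) h0.le

lemma measurable_boundaryValue : Measurable boundaryValue := by
  unfold boundaryValue
  have := measurable_tan
  fun_prop

lemma norm_boundaryValue_le {s : ℝ} (hs : 0 < s) (hc : Real.cos s ≠ 0) :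
    ‖boundaryValue s‖ ≤ Real.sqrt (2 / (|Real.cos s| * s)) := by
  refine Real.le_sqrt_of_sq_le ?_
  have hc' := abs_pos.2 hc
  rw [boundaryValue, ← symbolExt_mul_I, symbolExt, norm_rotSqrt_sq, tanh_mul_I_div,
    Complex.norm_real, norm_div, Real.norm_of_nonneg hs.le, Real.tan_eq_sin_div_cos, norm_div,
    Real.norm_eq_abs, Real.norm_eq_abs, div_div]
  have := Real.abs_sin_le_one s
  gcongr
  linarith

section
variable {C : ℝ} {h : ℂ → ℂ} (hh : IsContourWeight C h) {b : ℝ → ℝ}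
  (hb : ∀ s : ℝ, 0 < s → h (s * Complex.I) = b s)
include hh hb

lemma IsContourWeight.integrableOn_boundaryValue_mul (hbm : Measurable b) :
    IntegrableOn (fun s => boundaryValue s * (b s : ℂ)) (Ioi 0) := by
  refine Integrable.mono' (integrableOn_dominator.const_mul C)
    (measurable_boundaryValue.mul
      (Complex.measurable_ofReal.comp hbm)).aestronglyMeasurable ?_
  filter_upwards [ae_restrict_mem measurableSet_Ioi, ae_restrict_of_ae ae_cos_ne_zero] with s hs hc
  have hs0 : (0 : ℝ) < s := hs
  have h2 := hh.norm_le (s * Complex.I) (by simp) (by simp [hs0.le])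
  simp only [Complex.mul_im, Complex.ofReal_re, Complex.I_im,
    mul_one, Complex.I_re, mul_zero, add_zero] at h2
  rw [norm_mul, dominator, mul_div_left_comm, ← hb s hs]
  exact mul_le_mul (norm_boundaryValue_le hs hc) h2 (norm_nonneg _) (Real.sqrt_nonneg _)

lemma IsContourWeight.integrableOn_density_mul (hbm : Measurable b) :
    IntegrableOn (fun s => density s * b s) (Ioi 0) := by
  have h1 := (hh.integrableOn_boundaryValue_mul hb hbm).im.neg
  refine h1.congr (Eventually.of_forall fun s => ?_)
  simp [boundaryValue, density]

/-- When the weight is real on the imaginary axis, the factor `i` from the rotation makes the real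
part see only the imaginary part of `boundaryValue`, which is `-density`. -/
lemma IsContourWeight.tendsto_integral_re (hbm : Measurable b) (hc : Continuous fun t : ℝ => h t) :
    Tendsto (fun R : ℝ => ∫ t in (0 : ℝ)..R, symbol t * (h t).re) atTop
      (𝓝 (∫ s in Ioi (0 : ℝ), density s * b s)) := by
  have h1 := (Complex.continuous_re.tendsto _).comp (hh.tendsto_integral hc)
  have h2 : (Complex.I * ∫ s in Ioi (0 : ℝ), boundaryValue s * h (s * Complex.I)).re =
      ∫ s in Ioi (0 : ℝ), density s * b s := by
    have h3 : ∫ s in Ioi (0 : ℝ), boundaryValue s * h (s * Complex.I) =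
        ∫ s in Ioi (0 : ℝ), boundaryValue s * (b s : ℂ) :=
      setIntegral_congr_fun measurableSet_Ioi fun s hs => by
        simp only [hb s hs]
    have h4 := Complex.imCLM.integral_comp_comm (hh.integrableOn_boundaryValue_mul hb hbm)
    rw [Complex.imCLM_apply] at h4
    rw [Complex.I_mul_re, h3, ← h4, ← integral_neg]
    congr 1; ext s
    simp [boundaryValue, density]
  rw [h2] at h1
  refine h1.congr fun R => ?_
  have h5 := Complex.reCLM.intervalIntegral_comp_comm
    (intervalIntegrable_symbol_mul hc 0 R)
  simp only [Complex.reCLM_apply, Complex.re_ofReal_mul] at h5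
  exact h5.symm

end

lemma isContourWeight_exp {x : ℝ} (hx : 0 < x) :
    IsContourWeight (1 + 1 / x) fun z => Complex.exp (Complex.I * x * z) where
  differentiableAt z _ _ := by fun_prop
  norm_le z _ hz := by
    have h1 : (Complex.I * x * z).re = -(x * z.im) := by simp
    rw [Complex.norm_exp, h1, Real.exp_neg, inv_eq_one_div,
      div_le_div_iff₀ (Real.exp_pos _) (by linarith), one_mul]
    have h2 := Real.add_one_le_exp (x * z.im)
    have h3 : (1 + 1 / x) * (x * z.im + 1) ≤ (1 + 1 / x) * Real.exp (x * z.im) := by gcongr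
    refine le_trans ?_ h3
    have h4 : (1 + 1 / x) * (x * z.im + 1) = 1 + z.im + x * z.im + 1 / x := by field_simp; ring
    rw [h4]
    have : 0 ≤ x * z.im := by positivity
    have : 0 < 1 / x := by positivity
    linarith

/-- This weight has real part `ε / (ε² + t²)` on the real axis and value `1 / (ε + s)` at `is`. It
turns pointwise bounds on the symbol into integral bounds on the density. -/
lemma isContourWeight_inv {ε : ℝ} (hε : 0 < ε) :
    IsContourWeight (1 + 1 / ε) fun z => (ε - Complex.I * z)⁻¹ where
  differentiableAt z _ hz := by
    refine DifferentiableAt.inv (by fun_prop) fun h => ?_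
    have := congrArg Complex.re h
    simp at this
    linarith
  norm_le z _ hz := by
    have h1 : ε + z.im ≤ ‖(ε - Complex.I * z : ℂ)‖ := by
      have := Complex.re_le_norm (ε - Complex.I * z : ℂ)
      simpa using this
    rw [norm_inv, inv_eq_one_div, div_le_div_iff₀ (by linarith) (by linarith), one_mul]
    have h3 : (1 + 1 / ε) * (ε + z.im) ≤ (1 + 1 / ε) * ‖(ε - Complex.I * z : ℂ)‖ := by gcongr
    refine le_trans ?_ h3
    have h4 : (1 + 1 / ε) * (ε + z.im) = 1 + z.im + ε + z.im / ε := by field_simp; ring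
    rw [h4]
    have : 0 ≤ z.im / ε := by positivity
    linarith

/-- The Laplace transform of `density`. -/
noncomputable def densityLaplace (x : ℝ) : ℝ := ∫ s in Ioi (0 : ℝ), density s * Real.exp (-(x * s))

lemma integrableOn_density_mul_exp {x : ℝ} (hx : 0 < x) :
    IntegrableOn (fun s => density s * Real.exp (-(x * s))) (Ioi 0) :=
  (isContourWeight_exp hx).integrableOn_density_mul (fun s _ => by
    push_cast
    congr 1
    linear_combination (x * s : ℂ) * Complex.I_sq) (by fun_prop)

lemma integrableOn_density_mul_inv {ε : ℝ} (hε : 0 < ε) :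
    IntegrableOn (fun s => density s * (ε + s)⁻¹) (Ioi 0) :=
  (isContourWeight_inv hε).integrableOn_density_mul (fun s _ => by
    push_cast
    congr 1
    linear_combination -(s : ℂ) * Complex.I_sq) (by fun_prop)

lemma tendsto_integral_symbol_mul_cos {x : ℝ} (hx : 0 < x) :
    Tendsto (fun R : ℝ => ∫ t in (0 : ℝ)..R, symbol t * Real.cos (x * t)) atTop
      (𝓝 (densityLaplace x)) := by
  have := (isContourWeight_exp hx).tendsto_integral_re
    (b := fun s => Real.exp (-(x * s))) (fun s _ => by
      push_cast
      congr 1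
      linear_combination (x * s : ℂ) * Complex.I_sq) (by fun_prop) (by fun_prop)
  refine this.congr fun R => ?_
  congr 1; ext t
  rw [show Complex.I * x * t = ((x * t : ℝ) : ℂ) * Complex.I by push_cast; ring,
    Complex.exp_ofReal_mul_I_re]

lemma tendsto_integral_symbol_mul_poisson {ε : ℝ} (hε : 0 < ε) :
    Tendsto (fun R : ℝ => ∫ t in (0 : ℝ)..R, symbol t * (ε / (ε ^ 2 + t ^ 2))) atTop
      (𝓝 (∫ s in Ioi (0 : ℝ), density s * (ε + s)⁻¹)) := by
  have := (isContourWeight_inv hε).tendsto_integral_re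
    (b := fun s => (ε + s)⁻¹) (fun s _ => by
      push_cast
      congr 1
      linear_combination -(s : ℂ) * Complex.I_sq) (by fun_prop) (by
      refine Continuous.inv₀ (by fun_prop) fun t h => ?_
      have := congrArg Complex.re h
      simp at this
      linarith)
  refine this.congr fun R => ?_
  congr 1; ext t
  congr 1
  rw [Complex.inv_re, Complex.normSq_apply]
  simp
  ring

lemma integral_symmetric_eq (x R : ℝ) :
    (2 * (Real.pi : ℂ))⁻¹ *
      ∫ ξ in (-R)..R, (symbol ξ : ℂ) * Complex.exp (Complex.I * (x : ℂ) * (ξ : ℂ)) =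
    ((Real.pi⁻¹ * ∫ t in (0 : ℝ)..R, symbol t * Real.cos (|x| * t) : ℝ) : ℂ) := by
  set f : ℝ → ℂ := fun ξ => (symbol ξ : ℂ) * Complex.exp (Complex.I * (x : ℂ) * (ξ : ℂ)) with hf
  have hi : ∀ a b, IntervalIntegrable f volume a b :=
    fun a b => intervalIntegrable_symbol_mul (h := fun ξ : ℝ => Complex.exp (Complex.I * x * ξ))
      (by fun_prop) a b
  have h1 : ∫ ξ in (-R)..R, f ξ = ∫ ξ in (0 : ℝ)..R, (f (-ξ) + f ξ) := by
    rw [← intervalIntegral.integral_add_adjacent_intervals (hi (-R) 0) (hi 0 R),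
      intervalIntegral.integral_add _ (hi 0 R), intervalIntegral.integral_comp_neg, neg_zero]
    simp only [hf, symbol_neg]
    exact intervalIntegrable_symbol_mul
      (h := fun ξ : ℝ => Complex.exp (Complex.I * x * ((-ξ : ℝ) : ℂ))) (by fun_prop) 0 R
  have h2 : ∀ ξ : ℝ, f (-ξ) + f ξ = ((2 * (symbol ξ * Real.cos (|x| * ξ)) : ℝ) : ℂ) := by
    intro ξ
    have h3 : Real.cos (|x| * ξ) = Real.cos (x * ξ) := by
      rcases abs_choice x with h | h <;> rw [h]
      rw [neg_mul, Real.cos_neg]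
    rw [h3]
    simp only [hf, symbol_neg]
    push_cast
    rw [Complex.cos]
    rw [show Complex.I * (x : ℂ) * -(ξ : ℂ) = -((x : ℂ) * ξ) * Complex.I by ring,
      show Complex.I * (x : ℂ) * (ξ : ℂ) = (x : ℂ) * ξ * Complex.I by ring]
    ring
  rw [h1]
  simp only [h2]
  rw [intervalIntegral.integral_ofReal, intervalIntegral.integral_const_mul]
  push_cast
  have : (Real.pi : ℂ) ≠ 0 := by exact_mod_cast Real.pi_ne_zero
  field_simp

theorem kernel_eq {x : ℝ} (hx : x ≠ 0) : kernel x = Real.pi⁻¹ * densityLaplace |x| := by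
  have h1 : Tendsto (fun R : ℝ => (2 * (Real.pi : ℂ))⁻¹ *
      ∫ ξ in (-R)..R, (symbol ξ : ℂ) * Complex.exp (Complex.I * (x : ℂ) * (ξ : ℂ))) atTop
      (𝓝 ((Real.pi⁻¹ * densityLaplace |x| : ℝ) : ℂ)) := by
    simp only [integral_symmetric_eq]
    exact (Complex.continuous_ofReal.tendsto _).comp
      ((tendsto_integral_symbol_mul_cos (abs_pos.2 hx)).const_mul _)
  rw [kernel, invFourier, h1.limUnder_eq, Complex.ofReal_re]

lemma kernel_neg (x : ℝ) : kernel (-x) = kernel x := by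
  rcases eq_or_ne x 0 with rfl | hx
  · simp
  · rw [kernel_eq hx, kernel_eq (neg_ne_zero.2 hx), abs_neg]

/-! ### Size of the representing measure -/

/-- The symbol is at most 1, and the Poisson kernel has mass `π / 2` on a half-line. -/
lemma integral_density_mul_inv_le {ε : ℝ} (hε : 0 < ε) :
    ∫ s in Ioi (0 : ℝ), density s * (ε + s)⁻¹ ≤ Real.pi / 2 := by
  refine le_of_tendsto (tendsto_integral_symbol_mul_poisson hε) ?_
  filter_upwards [eventually_ge_atTop 0] with R hR
  have hc : Continuous fun t : ℝ => (1 + (t / ε) ^ 2)⁻¹ :=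
    Continuous.inv₀ (by fun_prop) fun t => by positivity
  have hc2 : Continuous fun t : ℝ => ε / (ε ^ 2 + t ^ 2) :=
    Continuous.div (by fun_prop) (by fun_prop) fun t => by positivity
  calc ∫ t in (0 : ℝ)..R, symbol t * (ε / (ε ^ 2 + t ^ 2))
      ≤ ∫ t in (0 : ℝ)..R, ε⁻¹ * (1 + (t / ε) ^ 2)⁻¹ := by
        refine intervalIntegral.integral_mono_on hR ?_
          ((hc.const_smul ε⁻¹).intervalIntegrable _ _) fun t _ => ?_
        · refine (hc2.intervalIntegrable 0 R).mono_fun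
            (measurable_symbol.mul hc2.measurable).aestronglyMeasurable
            (Eventually.of_forall fun t => ?_)
          beta_reduce
          rw [norm_mul, Real.norm_of_nonneg (symbol_nonneg t)]
          exact mul_le_of_le_one_left (norm_nonneg _) (symbol_le_one t)
        · refine (mul_le_of_le_one_left (by positivity) (symbol_le_one t)).trans_eq ?_
          field_simp
    _ = Real.arctan (R / ε) := by
        rw [intervalIntegral.integral_const_mul,
          intervalIntegral.integral_comp_div (fun t => (1 + t ^ 2)⁻¹) hε.ne',
          integral_inv_one_add_sq]
        simp [hε.ne']
    _ ≤ Real.pi / 2 := (Real.arctan_lt_pi_div_two _).le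

/-- Here the symbol is bounded by `t^(-1/2)`; the Poisson kernel is bounded by `1 / ε` below `ε` and
by `ε / t²` above it. -/
lemma integral_density_mul_inv_le_rpow {ε : ℝ} (hε : 0 < ε) :
    ∫ s in Ioi (0 : ℝ), density s * (ε + s)⁻¹ ≤ 3 * ε ^ (-(1 / 2) : ℝ) := by
  refine le_of_tendsto (tendsto_integral_symbol_mul_poisson hε) ?_
  filter_upwards [eventually_ge_atTop ε] with R hR
  have hc2 : Continuous fun t : ℝ => ε / (ε ^ 2 + t ^ 2) :=
    Continuous.div (by fun_prop) (by fun_prop) fun t => by positivity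
  have hi : ∀ a b, IntervalIntegrable (fun t => symbol t * (ε / (ε ^ 2 + t ^ 2))) volume a b := by
    intro a b
    refine (hc2.intervalIntegrable a b).mono_fun
      (measurable_symbol.mul hc2.measurable).aestronglyMeasurable (Eventually.of_forall fun t => ?_)
    beta_reduce
    rw [norm_mul, Real.norm_of_nonneg (symbol_nonneg t)]
    exact mul_le_of_le_one_left (norm_nonneg _) (symbol_le_one t)
  have hs : ∀ t : ℝ, 0 < t → symbol t ≤ t ^ (-(1 / 2) : ℝ) := fun t ht => by
    rw [Real.rpow_neg ht.le, ← Real.sqrt_eq_rpow]; exact symbol_le_inv_sqrt ht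
  have h1 : ∫ t in (0 : ℝ)..ε, symbol t * (ε / (ε ^ 2 + t ^ 2)) ≤ 2 * ε ^ (-(1 / 2) : ℝ) := by
    calc _ ≤ ∫ t in (0 : ℝ)..ε, ε⁻¹ * t ^ (-(1 / 2) : ℝ) := by
          refine intervalIntegral.integral_mono_on_of_le_Ioo hε.le (hi _ _)
            ((intervalIntegral.intervalIntegrable_rpow' (by norm_num)).const_mul _) fun t ht => ?_
          rw [mul_comm]
          refine mul_le_mul ?_ (hs t ht.1) (symbol_nonneg t) (by positivity)
          rw [inv_eq_one_div, div_le_div_iff₀ (by positivity) hε]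
          nlinarith [sq_nonneg t]
      _ = 2 * (ε⁻¹ * ε ^ (1 / 2 : ℝ)) := by
          rw [intervalIntegral.integral_const_mul, integral_rpow (Or.inl (by norm_num))]
          norm_num
          ring
      _ = _ := by
          rw [← Real.rpow_neg_one ε, ← Real.rpow_add hε]; norm_num
  have h2 : ∫ t in ε..R, symbol t * (ε / (ε ^ 2 + t ^ 2)) ≤ ε ^ (-(1 / 2) : ℝ) := by
    have h0 : (0 : ℝ) ∉ uIcc ε R := by
      rw [uIcc_of_le hR]; exact fun h => absurd h.1 (not_le.2 hε)
    have hint : ∀ r : ℝ, IntervalIntegrable (fun t : ℝ => t ^ r) volume ε R := fun r =>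
      intervalIntegral.intervalIntegrable_rpow (Or.inr h0)
    calc _ ≤ ∫ t in ε..R, ε * t ^ (-(5 / 2) : ℝ) := by
          refine intervalIntegral.integral_mono_on hR (hi _ _)
            ((hint _).const_mul _) fun t ht => ?_
          have ht0 : 0 < t := hε.trans_le ht.1
          calc symbol t * (ε / (ε ^ 2 + t ^ 2)) ≤ t ^ (-(1 / 2) : ℝ) * (ε / t ^ 2) := by
                refine mul_le_mul (hs t ht0) ?_ (by positivity) (by positivity)
                gcongr
                nlinarith [sq_nonneg ε]
            _ = _ := by
                rw [mul_div_left_comm, div_eq_mul_inv, ← Real.rpow_natCast t 2,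
                  ← Real.rpow_neg ht0.le, ← Real.rpow_add ht0]
                norm_num
      _ = ε * ((ε ^ (-(3 / 2) : ℝ) - R ^ (-(3 / 2) : ℝ)) * (2 / 3)) := by
          rw [intervalIntegral.integral_const_mul, integral_rpow (Or.inr ⟨by norm_num, h0⟩)]
          norm_num
          left; ring
      _ ≤ ε * ε ^ (-(3 / 2) : ℝ) := by
          have := Real.rpow_nonneg (hε.le.trans hR) (-(3 / 2) : ℝ)
          have := Real.rpow_nonneg hε.le (-(3 / 2) : ℝ)
          gcongr
          linarith
      _ = _ := by
          nth_rewrite 1 [← Real.rpow_one ε]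
          rw [← Real.rpow_add hε]; norm_num
  rw [← intervalIntegral.integral_add_adjacent_intervals (hi 0 ε) (hi ε R)]
  linarith

lemma integrableOn_density_mul_inv_self : IntegrableOn (fun s => density s * s⁻¹) (Ioi 0) := by
  refine Integrable.mono' ((integrableOn_density_mul_inv one_pos).const_mul 2)
    (measurable_density.mul measurable_inv).aestronglyMeasurable ?_
  filter_upwards [ae_restrict_mem measurableSet_Ioi] with s hs
  have hs0 : (0 : ℝ) < s := hs
  have := density_nonneg s
  rw [Real.norm_of_nonneg (by positivity)]
  rcases lt_or_ge s (Real.pi / 2) with h | h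
  · simp [density_eq_zero hs0 h]
  · rw [mul_left_comm]
    gcongr
    rw [← div_eq_mul_inv, inv_eq_one_div, div_le_div_iff₀ hs0 (by linarith)]
    linarith [Real.pi_gt_three]

/-- The density vanishes on `(0, π/2)`, and `1 / s ≤ (1 + ε) / (ε + s)` once `s ≥ 1`; then `ε → 0`.
By Tonelli this is the bound on the total mass of the kernel. -/
lemma integral_density_mul_inv_self_le :
    ∫ s in Ioi (0 : ℝ), density s * s⁻¹ ≤ Real.pi / 2 := by
  have h1 : ∀ ε : ℝ, 0 < ε →
      ∫ s in Ioi (0 : ℝ), density s * s⁻¹ ≤ (1 + ε) * (Real.pi / 2) := by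
    intro ε hε
    calc _ ≤ ∫ s in Ioi (0 : ℝ), (1 + ε) * (density s * (ε + s)⁻¹) := by
          refine setIntegral_mono_on integrableOn_density_mul_inv_self
            ((integrableOn_density_mul_inv hε).const_mul _) measurableSet_Ioi fun s hs => ?_
          have hs0 : (0 : ℝ) < s := hs
          have := density_nonneg s
          rcases lt_or_ge s (Real.pi / 2) with h | h
          · simp [density_eq_zero hs0 h]
          · rw [mul_left_comm]
            gcongr
            rw [← div_eq_mul_inv, inv_eq_one_div, div_le_div_iff₀ hs0 (by linarith)]
            nlinarith [Real.pi_gt_three]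
      _ ≤ _ := by
          rw [integral_const_mul]
          have := integral_density_mul_inv_le hε
          gcongr
  have h2 : Tendsto (fun ε : ℝ => (1 + ε) * (Real.pi / 2)) (𝓝[>] 0) (𝓝 ((1 + 0) * (Real.pi / 2))) :=
    (Continuous.tendsto (by fun_prop) 0).mono_left nhdsWithin_le_nhds
  rw [add_zero, one_mul] at h2
  refine ge_of_tendsto h2 ?_
  filter_upwards [self_mem_nhdsWithin] with ε hε using h1 ε hε

lemma integral_density_mul_pos {b : ℝ → ℝ} (hb : ∀ s, 0 < s → 0 < b s)
    (hi : IntegrableOn (fun s => density s * b s) (Ioi 0)) :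
    0 < ∫ s in Ioi (0 : ℝ), density s * b s := by
  rw [setIntegral_pos_iff_support_of_nonneg_ae _ hi]
  · refine lt_of_lt_of_le ?_ (measure_mono (s := Ioo (Real.pi / 2) Real.pi) ?_)
    · rw [Real.volume_Ioo]; simp [Real.pi_pos]
    · intro s hs
      have hs0 : 0 < s := lt_trans (by positivity) hs.1
      refine ⟨ne_of_gt (mul_pos (Real.sqrt_pos.2 (div_pos ?_ hs0)) (hb s hs0)), hs0⟩
      have h1 := Real.tan_neg_of_neg_of_pi_div_two_lt (x := s - Real.pi) (by linarith [hs.2])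
        (by linarith [hs.1])
      rw [Real.tan_sub_pi] at h1
      linarith
  · filter_upwards [ae_restrict_mem measurableSet_Ioi] with s hs
    exact mul_nonneg (density_nonneg s) (hb s hs).le

/-- On a quarter of each period the density is at least `s ^ (-1/2)`. -/
lemma le_mul_density {n : ℕ} {s : ℝ} (h1 : n * Real.pi + Real.pi / 2 < s)
    (h2 : s ≤ n * Real.pi + 3 * Real.pi / 4) : Real.sqrt s ≤ s * density s := by
  have hn : (0 : ℝ) ≤ n := n.cast_nonneg
  have hp := Real.pi_pos
  have hs0 : 0 < s := lt_trans (by positivity) h1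
  have ht : 1 ≤ -Real.tan s := by
    have h3 : Real.tan (s - (n + 1 : ℕ) * Real.pi) = Real.tan s := Real.tan_sub_nat_mul_pi s (n + 1)
    rw [← h3, ← Real.tan_neg, ← Real.tan_pi_div_four]
    push_cast
    exact Real.strictMonoOn_tan.monotoneOn ⟨by linarith, by linarith⟩
      ⟨by linarith, by linarith⟩ (by linarith)
  calc Real.sqrt s = s * Real.sqrt (1 / s) := by
        rw [Real.sqrt_div zero_le_one, Real.sqrt_one, mul_one_div, Real.div_sqrt]
    _ ≤ s * density s := by
        unfold density
        gcongr

lemma integrableOn_density_mul_pow_mul_exp (k : ℕ) {y : ℝ} (hy : 0 < y) :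
    IntegrableOn (fun s => density s * (s ^ k * Real.exp (-(y * s)))) (Ioi 0) := by
  refine Integrable.mono' ((integrableOn_density_mul_exp (half_pos hy)).const_mul
    (k.factorial * (2 / y) ^ k)) (measurable_density.mul (by fun_prop)).aestronglyMeasurable ?_
  filter_upwards [ae_restrict_mem measurableSet_Ioi] with s hs
  have hs0 : (0 : ℝ) < s := hs
  have := density_nonneg s
  rw [Real.norm_of_nonneg (by positivity), mul_left_comm (_ * _) (density s)]
  refine mul_le_mul_of_nonneg_left ?_ this
  have h1 := Real.pow_div_factorial_le_exp (y / 2 * s) (by positivity) k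
  rw [div_le_iff₀ (by positivity)] at h1
  calc s ^ k * Real.exp (-(y * s)) = (2 / y) ^ k * (y / 2 * s) ^ k * Real.exp (-(y * s)) := by
        rw [← mul_pow]; congr 2; field_simp
    _ ≤ (2 / y) ^ k * (Real.exp (y / 2 * s) * k.factorial) * Real.exp (-(y * s)) := by gcongr
    _ = _ := by
        rw [show -(y * s) = -(y / 2 * s) + -(y / 2 * s) by ring, Real.exp_add,
          Real.exp_neg (y / 2 * s)]
        field_simp

/-- Only the `N` periods between `Nπ` and `2Nπ` are kept, with `N = ⌈1/y⌉`. There `y s ≤ 4π`, so the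
exponential costs a constant, and a quarter of each period contributes at least a multiple of `√N`.
The sum is of order `N^(3/2) ≥ y^(-3/2)`. -/
lemma le_integral_density_mul_exp {y : ℝ} (hy : 0 < y) (hy1 : y ≤ 1) :
    Real.pi / 4 * Real.exp (-(4 * Real.pi)) * y ^ (-(3 / 2) : ℝ) ≤
      ∫ s in Ioi (0 : ℝ), density s * (s ^ 1 * Real.exp (-(y * s))) := by
  set N : ℕ := ⌈1 / y⌉₊ with hN
  have hN1 : 1 / y ≤ N := Nat.le_ceil _
  have hN2 : y * N ≤ 2 := by
    have : (N : ℝ) < 1 / y + 1 := Nat.ceil_lt_add_one (by positivity)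
    have h3 : y * N ≤ y * (1 / y + 1) := by gcongr
    rw [mul_add, mul_one_div_cancel hy.ne'] at h3
    linarith
  have hp := Real.pi_gt_three
  set f : ℝ → ℝ := fun s => density s * (s ^ 1 * Real.exp (-(y * s))) with hf
  have hf0 : ∀ s, 0 < s → 0 ≤ f s := fun s hs => by
    have := density_nonneg s
    simp only [hf]; positivity
  have hfi : IntegrableOn f (Ioi 0) := integrableOn_density_mul_pow_mul_exp 1 hy
  have hN0 : (1 : ℝ) ≤ N := le_trans (by rw [le_div_iff₀ hy]; linarith) hN1
  have hint : ∀ a b : ℝ, 0 ≤ a → a ≤ b → IntervalIntegrable f volume a b := fun a b ha hab =>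
    (intervalIntegrable_iff_integrableOn_Ioc_of_le hab).2
      (hfi.mono_set fun s hs => lt_of_le_of_lt ha hs.1)
  have hstep : ∀ k : ℕ, k < N → Real.pi / 4 * (Real.sqrt N * Real.exp (-(4 * Real.pi))) ≤
      ∫ s in ((N + k : ℕ) : ℝ) * Real.pi..((N + (k + 1) : ℕ) : ℝ) * Real.pi, f s := by
    intro k hk
    have hk1 : (k : ℝ) + 1 ≤ N := by exact_mod_cast hk
    have hk0 : (0 : ℝ) ≤ k := k.cast_nonneg
    set A : ℝ := ((N + k : ℕ) : ℝ) * Real.pi with hA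
    have hA' : A = (N + k) * Real.pi := by rw [hA]; push_cast; ring
    have hA0 : 0 < A := by rw [hA']; positivity
    have hB : ((N + (k + 1) : ℕ) : ℝ) * Real.pi = A + Real.pi := by rw [hA]; push_cast; ring
    rw [hB]
    calc Real.pi / 4 * (Real.sqrt N * Real.exp (-(4 * Real.pi)))
        = ∫ s in A + Real.pi / 2..A + 3 * Real.pi / 4,
            (Real.sqrt N * Real.exp (-(4 * Real.pi))) := by
          rw [intervalIntegral.integral_const, smul_eq_mul]; ring
      _ ≤ ∫ s in A + Real.pi / 2..A + 3 * Real.pi / 4, f s := by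
          refine intervalIntegral.integral_mono_on_of_le_Ioo (by linarith) (by simp)
            (hint _ _ (by linarith) (by linarith)) fun s hs => ?_
          have h1 := le_mul_density (n := N + k) (s := s) hs.1 hs.2.le
          have hNs : (N : ℝ) ≤ s := by
            have := hs.1
            rw [hA'] at this
            nlinarith
          have h2 : Real.sqrt N ≤ Real.sqrt s := Real.sqrt_le_sqrt hNs
          have h3 : y * s ≤ 4 * Real.pi := by
            have h4 : s ≤ 2 * N * Real.pi := by
              have := hs.2
              rw [hA'] at this
              nlinarith
            calc y * s ≤ y * (2 * N * Real.pi) := by gcongr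
              _ = (y * N) * (2 * Real.pi) := by ring
              _ ≤ 2 * (2 * Real.pi) := by gcongr
              _ = _ := by ring
          simp only [hf]
          rw [pow_one, ← mul_assoc, mul_comm (density s)]
          exact mul_le_mul (h2.trans h1) (Real.exp_le_exp.2 (by linarith)) (Real.exp_pos _).le
            ((Real.sqrt_nonneg _).trans h1)
      _ ≤ ∫ s in A..A + Real.pi, f s := by
          refine intervalIntegral.integral_mono_interval (by linarith) (by linarith) (by linarith) ?_
            (hint _ _ hA0.le (by linarith))
          filter_upwards [ae_restrict_mem measurableSet_Ioc] with s hs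
          exact hf0 s (hA0.trans hs.1)
  have hsum := intervalIntegral.sum_integral_adjacent_intervals (μ := volume) (f := f)
    (a := fun k : ℕ => ((N + k : ℕ) : ℝ) * Real.pi) (n := N) (fun k _ => hint _ _ (by positivity)
      (by push_cast; nlinarith))
  have h5 : (N : ℝ) * (Real.pi / 4 * (Real.sqrt N * Real.exp (-(4 * Real.pi)))) ≤
      ∫ s in ((N + 0 : ℕ) : ℝ) * Real.pi..((N + N : ℕ) : ℝ) * Real.pi, f s := by
    rw [← hsum, ← nsmul_eq_mul, ← Finset.card_range N, ← Finset.sum_const, Finset.card_range]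
    exact Finset.sum_le_sum fun k hk => hstep k (Finset.mem_range.1 hk)
  have h6 : ∫ s in ((N + 0 : ℕ) : ℝ) * Real.pi..((N + N : ℕ) : ℝ) * Real.pi, f s ≤
      ∫ s in Ioi (0 : ℝ), f s := by
    rw [intervalIntegral.integral_of_le (by push_cast; nlinarith)]
    refine setIntegral_mono_set hfi ?_ (LE.le.eventuallyLE fun s hs =>
      lt_of_le_of_lt (by positivity) hs.1)
    filter_upwards [ae_restrict_mem measurableSet_Ioi] with s hs using hf0 s hs
  have h7 : y ^ (-(3 / 2) : ℝ) ≤ N * Real.sqrt N := by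
    calc y ^ (-(3 / 2) : ℝ) = (1 / y) * Real.sqrt (1 / y) := by
          rw [Real.sqrt_eq_rpow, one_div, ← Real.rpow_neg_one, ← Real.rpow_mul hy.le,
            ← Real.rpow_add hy]
          norm_num
      _ ≤ _ := by gcongr
  calc _ ≤ Real.pi / 4 * Real.exp (-(4 * Real.pi)) * (N * Real.sqrt N) := by gcongr
    _ = (N : ℝ) * (Real.pi / 4 * (Real.sqrt N * Real.exp (-(4 * Real.pi)))) := by ring
    _ ≤ _ := h5.trans h6

/-! ### Properties of the Whitham kernel -/

/-- The properties of the Whitham kernel that the symmetry argument uses. -/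
structure IsCuspKernel (K : ℝ → ℝ) : Prop where
  even : ∀ x, K (-x) = K x
  integrable : Integrable K
  integral_le_one : ∫ x, K x ≤ 1
  pos : ∀ x, x ≠ 0 → 0 < K x
  anti : ∀ x y, 0 < x → x < y → K y < K x
  exp_moment : ∃ ν : ℝ, 0 < ν ∧ Integrable fun x => K x * Real.exp (ν * |x|)
  le_rpow : ∃ C : ℝ, 0 < C ∧ ∀ x, 0 < x → K x ≤ C * x ^ (-(1 / 2) : ℝ)
  second_diff_le : ∃ C : ℝ, 0 < C ∧ ∀ x y, 0 < x → x < y →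
    K (y - x) - 2 * K y + K (y + x) ≤ C * x ^ 2 * (y - x) ^ (-(5 / 2) : ℝ)
  le_diff : ∃ κ : ℝ, 0 < κ ∧ ∀ x y, 0 < x → x < y → y ≤ 1 →
    κ * x * y ^ (-(3 / 2) : ℝ) ≤ K (y - x) - K (y + x)

lemma integrable_comp_abs {f : ℝ → ℝ} (hf : IntegrableOn f (Ioi 0)) :
    Integrable fun x => f |x| := by
  have h1 : IntegrableOn (fun x => f |x|) (Ioi 0) :=
    hf.congr_fun (fun x hx => by rw [abs_of_pos hx]) measurableSet_Ioi
  have h2 : IntegrableOn (fun x ↦ f |x|) (Iic 0) := by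
    rw [← Measure.map_neg_eq_self (volume : Measure ℝ)]
    have m : MeasurableEmbedding fun x : ℝ => -x := (Homeomorph.neg ℝ).measurableEmbedding
    rw [m.integrableOn_map_iff]
    simp_rw [Function.comp_def, abs_neg, neg_preimage, neg_Iic, neg_zero]
    exact Iff.mpr integrableOn_Ici_iff_integrableOn_Ioi h1
  rw [← integrableOn_univ, ← Iic_union_Ioi (a := (0 : ℝ))]
  exact h2.union h1

lemma densityLaplace_nonneg (x : ℝ) : 0 ≤ densityLaplace x :=
  setIntegral_nonneg measurableSet_Ioi fun s _ => mul_nonneg (density_nonneg s) (Real.exp_pos _).le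

lemma densityLaplace_pos {x : ℝ} (hx : 0 < x) : 0 < densityLaplace x :=
  integral_density_mul_pos (fun _ _ => Real.exp_pos _) (integrableOn_density_mul_exp hx)

lemma densityLaplace_lt {x y : ℝ} (hx : 0 < x) (hxy : x < y) :
    densityLaplace y < densityLaplace x := by
  have h1 := integrableOn_density_mul_exp hx
  have h2 := integrableOn_density_mul_exp (hx.trans hxy)
  rw [← sub_pos, densityLaplace, densityLaplace, ← integral_sub h1 h2]
  have h3 : (fun s => density s * Real.exp (-(x * s)) - density s * Real.exp (-(y * s))) =
      fun s => density s * (Real.exp (-(x * s)) - Real.exp (-(y * s))) := by ext s; ring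
  rw [h3]
  refine integral_density_mul_pos (fun s hs => sub_pos.2 (Real.exp_lt_exp.2 ?_))
    (by rw [← h3]; exact h1.sub h2)
  nlinarith

lemma measurable_densityLaplace : Measurable densityLaplace := by
  refine (StronglyMeasurable.integral_prod_right (f := fun x s : ℝ =>
    density s * Real.exp (-(x * s))) (Measurable.stronglyMeasurable ?_)).measurable
  have := measurable_density
  unfold Function.uncurry
  fun_prop

/-- Tonelli in lower-integral form, so that integrability of the Laplace transform follows together
with its mass. -/
lemma lintegral_densityLaplace :
    ∫⁻ x in Ioi (0 : ℝ), ENNReal.ofReal (densityLaplace x) =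
      ENNReal.ofReal (∫ s in Ioi (0 : ℝ), density s * s⁻¹) := by
  have hd := measurable_density
  calc ∫⁻ x in Ioi (0 : ℝ), ENNReal.ofReal (densityLaplace x)
      = ∫⁻ x in Ioi (0 : ℝ), ∫⁻ s in Ioi (0 : ℝ),
          ENNReal.ofReal (density s * Real.exp (-(x * s))) := by
        refine setLIntegral_congr_fun measurableSet_Ioi fun x hx => ?_
        exact ofReal_integral_eq_lintegral_ofReal (integrableOn_density_mul_exp hx)
          (Eventually.of_forall fun s => mul_nonneg (density_nonneg s) (Real.exp_pos _).le)
    _ = ∫⁻ s in Ioi (0 : ℝ), ∫⁻ x in Ioi (0 : ℝ),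
          ENNReal.ofReal (density s * Real.exp (-(x * s))) := by
        refine lintegral_lintegral_swap (Measurable.aemeasurable ?_)
        unfold Function.uncurry
        fun_prop
    _ = ∫⁻ s in Ioi (0 : ℝ), ENNReal.ofReal (density s * s⁻¹) := by
        refine setLIntegral_congr_fun measurableSet_Ioi fun s hs => ?_
        have hs0 : (0 : ℝ) < s := hs
        have h1 := (integrableOn_exp_mul_Ioi (neg_neg_of_pos hs0) 0).const_mul (density s)
        have h2 := ofReal_integral_eq_lintegral_ofReal h1
          (Eventually.of_forall fun x => mul_nonneg (density_nonneg s) (Real.exp_pos _).le)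
        rw [integral_const_mul, integral_exp_mul_Ioi (neg_neg_of_pos hs0)] at h2
        have h3 : -Real.exp (-s * 0) / -s = s⁻¹ := by simp [neg_div_neg_eq]
        rw [h3] at h2
        rw [h2]
        refine lintegral_congr fun x => ?_
        rw [neg_mul, mul_comm s x]
    _ = _ := by
        refine (ofReal_integral_eq_lintegral_ofReal integrableOn_density_mul_inv_self ?_).symm
        filter_upwards [ae_restrict_mem measurableSet_Ioi] with s hs
        have hs0 : (0 : ℝ) < s := hs
        have := density_nonneg s
        simp only [Pi.zero_apply]
        positivity

lemma integrableOn_densityLaplace : IntegrableOn densityLaplace (Ioi 0) := by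
  refine ⟨measurable_densityLaplace.aestronglyMeasurable, ?_⟩
  rw [hasFiniteIntegral_iff_ofReal (Eventually.of_forall densityLaplace_nonneg),
    lintegral_densityLaplace]
  exact ENNReal.ofReal_lt_top

lemma integral_densityLaplace_le : ∫ x in Ioi (0 : ℝ), densityLaplace x ≤ Real.pi / 2 := by
  rw [integral_eq_lintegral_of_nonneg_ae (Eventually.of_forall densityLaplace_nonneg)
    measurable_densityLaplace.aestronglyMeasurable, lintegral_densityLaplace, ENNReal.toReal_ofReal]
  · exact integral_density_mul_inv_self_le
  · exact setIntegral_nonneg measurableSet_Ioi fun s hs => by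
      have hs0 : (0 : ℝ) < s := hs
      have := density_nonneg s
      positivity

/-- The inequality `exp (-(x s)) ≤ 1 / (1 + x s)` reduces this to the weight `1 / (ε + s)` with `ε =
1 / x`. -/
lemma densityLaplace_le_rpow {x : ℝ} (hx : 0 < x) :
    densityLaplace x ≤ 3 * x ^ (-(1 / 2) : ℝ) := by
  have hx' : 0 < x⁻¹ := inv_pos.2 hx
  calc densityLaplace x ≤ ∫ s in Ioi (0 : ℝ), x⁻¹ * (density s * (x⁻¹ + s)⁻¹) := by
        refine setIntegral_mono_on (integrableOn_density_mul_exp hx)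
          ((integrableOn_density_mul_inv hx').const_mul _) measurableSet_Ioi fun s hs => ?_
        have hs0 : (0 : ℝ) < s := hs
        rw [mul_left_comm]
        refine mul_le_mul_of_nonneg_left ?_ (density_nonneg s)
        rw [← mul_inv, Real.exp_neg]
        refine inv_anti₀ (by positivity) ?_
        rw [mul_add, mul_inv_cancel₀ hx.ne', add_comm]
        exact Real.add_one_le_exp _
    _ ≤ x⁻¹ * (3 * x⁻¹ ^ (-(1 / 2) : ℝ)) := by
        rw [integral_const_mul]
        exact mul_le_mul_of_nonneg_left (integral_density_mul_inv_le_rpow hx') hx'.le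
    _ = _ := by
        rw [mul_left_comm, ← Real.rpow_neg_one x, ← Real.rpow_mul hx.le, ← Real.rpow_add hx]
        norm_num

/-- Under the integral the second difference is `exp (-(t s)) (1 - exp (-(x s)))²` with `t = y - x`,
at most `(x s)² exp (-(t s))`. Half of the exponential absorbs `s²` at the price of `8 / t²`; the
other half gives the Laplace transform at `t / 2`. -/
lemma densityLaplace_second_diff_le {x y : ℝ} (hx : 0 < x) (hxy : x < y) :
    densityLaplace (y - x) - 2 * densityLaplace y + densityLaplace (y + x) ≤
      48 * x ^ 2 * (y - x) ^ (-(5 / 2) : ℝ) := by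
  set t := y - x with ht
  have ht0 : 0 < t := sub_pos.2 hxy
  have h1 := integrableOn_density_mul_exp ht0
  have h2 := integrableOn_density_mul_exp (hx.trans hxy)
  have h3 := integrableOn_density_mul_exp (show 0 < y + x by linarith)
  have h12 : IntegrableOn (fun s => density s * Real.exp (-(t * s)) -
    2 * (density s * Real.exp (-(y * s)))) (Ioi 0) := h1.sub (h2.const_mul 2)
  have h4 : densityLaplace t - 2 * densityLaplace y + densityLaplace (y + x) =
      ∫ s in Ioi (0 : ℝ), (density s * Real.exp (-(t * s)) -
        2 * (density s * Real.exp (-(y * s))) + density s * Real.exp (-((y + x) * s))) := by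
    rw [integral_add h12 h3, integral_sub h1 (h2.const_mul 2), integral_const_mul]
    rfl
  rw [h4]
  calc _ ≤ ∫ s in Ioi (0 : ℝ), (8 * x ^ 2 / t ^ 2) * (density s * Real.exp (-(t / 2 * s))) := by
        refine setIntegral_mono_on (h12.add h3)
          ((integrableOn_density_mul_exp (half_pos ht0)).const_mul _) measurableSet_Ioi
          fun s hs => ?_
        have hs0 : (0 : ℝ) < s := hs
        have e1 : Real.exp (-(y * s)) = Real.exp (-(t * s)) * Real.exp (-(x * s)) := by
          rw [← Real.exp_add]; congr 1; rw [ht]; ring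
        have e2 : Real.exp (-((y + x) * s)) = Real.exp (-(t * s)) * Real.exp (-(x * s)) ^ 2 := by
          rw [← Real.exp_nat_mul, ← Real.exp_add]; congr 1; rw [ht]; push_cast; ring
        have e3 : Real.exp (-(t * s)) = Real.exp (-(t / 2 * s)) * (Real.exp (t / 2 * s))⁻¹ := by
          rw [← Real.exp_neg, ← Real.exp_add]; congr 1; ring
        have h5 : (1 - Real.exp (-(x * s))) ^ 2 ≤ (x * s) ^ 2 := by
          have := Real.one_sub_le_exp_neg (x * s)
          have h6 : Real.exp (-(x * s)) ≤ 1 := Real.exp_le_one_iff.2 (by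
            have : 0 < x * s := by positivity
            linarith)
          exact pow_le_pow_left₀ (by linarith) (by linarith) 2
        have h7 : (x * s) ^ 2 * (Real.exp (t / 2 * s))⁻¹ ≤ 8 * x ^ 2 / t ^ 2 := by
          have := Real.quadratic_le_exp_of_nonneg (show 0 ≤ t / 2 * s by positivity)
          have h8 : (t * s) ^ 2 ≤ 8 * Real.exp (t / 2 * s) := by
            have : 0 < t * s := by positivity
            nlinarith
          rw [← div_eq_mul_inv, div_le_div_iff₀ (Real.exp_pos _) (by positivity)]
          calc (x * s) ^ 2 * t ^ 2 = x ^ 2 * (t * s) ^ 2 := by ring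
            _ ≤ x ^ 2 * (8 * Real.exp (t / 2 * s)) := by gcongr
            _ = _ := by ring
        have hd := density_nonneg s
        calc _ = density s * Real.exp (-(t * s)) * (1 - Real.exp (-(x * s))) ^ 2 := by
              rw [e1, e2]; ring
          _ ≤ density s * Real.exp (-(t * s)) * (x * s) ^ 2 := by gcongr
          _ = density s * Real.exp (-(t / 2 * s)) * ((x * s) ^ 2 * (Real.exp (t / 2 * s))⁻¹) := by
              rw [e3]; ring
          _ ≤ density s * Real.exp (-(t / 2 * s)) * (8 * x ^ 2 / t ^ 2) := by gcongr
          _ = _ := by ring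
    _ = (8 * x ^ 2 / t ^ 2) * densityLaplace (t / 2) := by rw [integral_const_mul]; rfl
    _ ≤ (8 * x ^ 2 / t ^ 2) * (3 * (t / 2) ^ (-(1 / 2) : ℝ)) := by
        have := densityLaplace_le_rpow (half_pos ht0)
        gcongr
    _ ≤ (8 * x ^ 2 / t ^ 2) * (6 * t ^ (-(1 / 2) : ℝ)) := by
        have h9 : (t / 2) ^ (-(1 / 2) : ℝ) ≤ 2 * t ^ (-(1 / 2) : ℝ) := by
          rw [Real.div_rpow ht0.le (by norm_num), Real.rpow_neg (by norm_num : (0 : ℝ) ≤ 2),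
            div_inv_eq_mul, mul_comm]
          gcongr
          calc (2 : ℝ) ^ (1 / 2 : ℝ) ≤ 2 ^ (1 : ℝ) :=
                Real.rpow_le_rpow_of_exponent_le (by norm_num) (by norm_num)
            _ = 2 := Real.rpow_one 2
        refine mul_le_mul_of_nonneg_left ?_ (by positivity)
        linarith
    _ = 48 * x ^ 2 * (t ^ (-2 : ℝ) * t ^ (-(1 / 2) : ℝ)) := by
        rw [Real.rpow_neg ht0.le 2, Real.rpow_two]; ring
    _ = _ := by rw [← Real.rpow_add ht0]; norm_num

/-- The difference of exponentials is `2 exp (-(y s)) sinh (x s)`, and `sinh u ≥ u`. -/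
lemma le_densityLaplace_sub {x y : ℝ} (hx : 0 < x) (hxy : x < y) (hy : y ≤ 1) :
    2 * (Real.pi / 4 * Real.exp (-(4 * Real.pi))) * x * y ^ (-(3 / 2) : ℝ) ≤
      densityLaplace (y - x) - densityLaplace (y + x) := by
  have hy0 := hx.trans hxy
  have h1 := integrableOn_density_mul_exp (sub_pos.2 hxy)
  have h2 := integrableOn_density_mul_exp (show 0 < y + x by linarith)
  calc _ = 2 * x * (Real.pi / 4 * Real.exp (-(4 * Real.pi)) * y ^ (-(3 / 2) : ℝ)) := by ring
    _ ≤ 2 * x * ∫ s in Ioi (0 : ℝ), density s * (s ^ 1 * Real.exp (-(y * s))) := by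
        have := le_integral_density_mul_exp hy0 hy
        gcongr
    _ = ∫ s in Ioi (0 : ℝ), 2 * x * (density s * (s ^ 1 * Real.exp (-(y * s)))) := by
        rw [integral_const_mul]
    _ ≤ ∫ s in Ioi (0 : ℝ), (density s * Real.exp (-((y - x) * s)) -
          density s * Real.exp (-((y + x) * s))) := by
        refine setIntegral_mono_on ((integrableOn_density_mul_pow_mul_exp 1 hy0).const_mul _)
          (h1.sub h2) measurableSet_Ioi fun s hs => ?_
        have hs0 : (0 : ℝ) < s := hs
        have hd := density_nonneg s
        have e1 : Real.exp (-((y - x) * s)) = Real.exp (-(y * s)) * Real.exp (x * s) := by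
          rw [← Real.exp_add]; congr 1; ring
        have e2 : Real.exp (-((y + x) * s)) = Real.exp (-(y * s)) * Real.exp (-(x * s)) := by
          rw [← Real.exp_add]; congr 1; ring
        have h3 : 2 * (x * s) ≤ Real.exp (x * s) - Real.exp (-(x * s)) := by
          have := Real.self_le_sinh_iff.2 (show 0 ≤ x * s by positivity)
          rw [Real.sinh_eq] at this
          linarith
        calc 2 * x * (density s * (s ^ 1 * Real.exp (-(y * s))))
            = density s * Real.exp (-(y * s)) * (2 * (x * s)) := by ring
          _ ≤ density s * Real.exp (-(y * s)) * (Real.exp (x * s) - Real.exp (-(x * s))) := by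
              gcongr
          _ = _ := by rw [e1, e2]; ring
    _ = _ := by rw [integral_sub h1 h2]; rfl

/-- The spectral gap, namely that the density is zero on `(0, π/2)`, is what gives the kernel an
exponential moment. -/
lemma densityLaplace_mul_exp_le {x : ℝ} (hx : 0 < x) :
    densityLaplace x * Real.exp (Real.pi / 4 * x) ≤ densityLaplace (x / 2) := by
  rw [densityLaplace, ← integral_mul_const]
  refine setIntegral_mono_on ((integrableOn_density_mul_exp hx).mul_const _)
    (integrableOn_density_mul_exp (half_pos hx)) measurableSet_Ioi fun s hs => ?_
  have hs0 : (0 : ℝ) < s := hs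
  rcases lt_or_ge s (Real.pi / 2) with h | h
  · simp [density_eq_zero hs0 h]
  · rw [mul_assoc, ← Real.exp_add]
    refine mul_le_mul_of_nonneg_left (Real.exp_le_exp.2 ?_) (density_nonneg s)
    nlinarith

lemma ae_ne_zero : ∀ᵐ x : ℝ, x ≠ 0 := by
  rw [ae_iff]; simp

theorem isCuspKernel_kernel : IsCuspKernel kernel := by
  have hpi := Real.pi_pos
  have hpos : ∀ x : ℝ, 0 < x → kernel x = Real.pi⁻¹ * densityLaplace x := fun x hx => by
    rw [kernel_eq hx.ne', abs_of_pos hx]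
  have hae : (fun x => Real.pi⁻¹ * densityLaplace |x|) =ᵐ[volume] kernel := by
    filter_upwards [ae_ne_zero] with x hx using (kernel_eq hx).symm
  have hint : Integrable kernel :=
    ((integrable_comp_abs integrableOn_densityLaplace).const_mul _).congr hae
  refine ⟨kernel_neg, hint, ?_, fun x hx => ?_, fun x y hx hxy => ?_,
    ⟨Real.pi / 4, by positivity, ?_⟩,
    ⟨Real.pi⁻¹ * 3, by positivity, fun x hx => ?_⟩,
    ⟨Real.pi⁻¹ * 48, by positivity, fun x y hx hxy => ?_⟩,
    ⟨Real.pi⁻¹ * (2 * (Real.pi / 4 * Real.exp (-(4 * Real.pi)))), by positivity,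
      fun x y hx hxy hy => ?_⟩⟩
  · rw [← integral_congr_ae hae, integral_const_mul, integral_comp_abs]
    have := integral_densityLaplace_le
    calc _ ≤ Real.pi⁻¹ * (2 * (Real.pi / 2)) := by gcongr
      _ = 1 := by field_simp
  · rw [kernel_eq hx]
    have := densityLaplace_pos (abs_pos.2 hx)
    positivity
  · rw [hpos x hx, hpos y (hx.trans hxy)]
    have := densityLaplace_lt hx hxy
    gcongr
  · refine Integrable.mono' (hint.comp_div two_ne_zero)
      (hint.aestronglyMeasurable.mul (Continuous.aestronglyMeasurable (by fun_prop))) ?_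
    filter_upwards [ae_ne_zero] with x hx
    have hx' := abs_pos.2 hx
    rw [kernel_eq hx, kernel_eq (div_ne_zero hx two_ne_zero), abs_div, abs_two,
      Real.norm_of_nonneg (by have := densityLaplace_nonneg |x|; positivity), mul_assoc]
    have := densityLaplace_mul_exp_le hx'
    gcongr
  · rw [hpos x hx, mul_assoc]
    have := densityLaplace_le_rpow hx
    gcongr
  · rw [hpos _ (sub_pos.2 hxy), hpos y (hx.trans hxy), hpos (y + x) (by linarith)]
    have := mul_le_mul_of_nonneg_left (densityLaplace_second_diff_le hx hxy) (inv_pos.2 hpi).le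
    linarith
  · rw [hpos _ (sub_pos.2 hxy), hpos (y + x) (by linarith)]
    have := mul_le_mul_of_nonneg_left (le_densityLaplace_sub hx hxy hy) (inv_pos.2 hpi).le
    linarith

/-! ### Convolutions with even and odd functions on the half-line -/

lemma integral_eq_integral_Ioi_add {f : ℝ → ℝ} (hf : Integrable f) :
    ∫ y, f y = ∫ y in Ioi (0 : ℝ), (f y + f (-y)) := by
  rw [integral_add hf.integrableOn hf.comp_neg.integrableOn, integral_comp_neg_Ioi, neg_zero,
    add_comm, intervalIntegral.integral_Iic_add_Ioi hf.integrableOn hf.integrableOn]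

section
variable {K : ℝ → ℝ} (hK : IsCuspKernel K)
include hK

lemma IsCuspKernel.apply_abs (x : ℝ) : K |x| = K x := by
  rcases abs_choice x with h | h <;> rw [h]
  exact hK.even x

lemma IsCuspKernel.lt_of_abs_lt {x y : ℝ} (hx : x ≠ 0) (h : |x| < |y|) : K y < K x := by
  rw [← hK.apply_abs x, ← hK.apply_abs y]
  exact hK.anti _ _ (abs_pos.2 hx) h

lemma IsCuspKernel.diff_pos {x y : ℝ} (hx : 0 < x) (hy : 0 < y) (hxy : y ≠ x) :
    0 < K (x - y) - K (x + y) := by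
  refine sub_pos.2 (hK.lt_of_abs_lt (sub_ne_zero.2 hxy.symm) ?_)
  rw [abs_of_pos (add_pos hx hy), abs_lt]
  constructor <;> linarith

lemma IsCuspKernel.integrable_mul {g : ℝ → ℝ} (hg : Continuous g) {M : ℝ} (hM : ∀ y, |g y| ≤ M)
    (x : ℝ) : Integrable fun y => K (x - y) * g y :=
  (hK.integrable.comp_sub_left x).mul_bdd (c := M) hg.aestronglyMeasurable
    (Eventually.of_forall hM)

lemma IsCuspKernel.integrableOn_diff_mul {g : ℝ → ℝ} (hg : Continuous g) {M : ℝ}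
    (hM : ∀ y, |g y| ≤ M) (x : ℝ) :
    IntegrableOn (fun y => (K (x - y) - K (x + y)) * g y) (Ioi 0) := by
  have h1 := hK.integrable_mul hg hM x
  have h2 := hK.integrable_mul hg hM (-x)
  refine (h1.sub h2).integrableOn.congr (Eventually.of_forall fun y => ?_)
  have : K (-x - y) = K (x + y) := by rw [← hK.even]; congr 1; ring
  simp only [Pi.sub_apply, this]
  ring

lemma IsCuspKernel.integral_mul_odd {w : ℝ → ℝ} (hw : Continuous w) {M : ℝ} (hM : ∀ y, |w y| ≤ M)
    (hodd : ∀ y, w (-y) = -w y) (x : ℝ) :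
    ∫ y, K (x - y) * w y = ∫ y in Ioi (0 : ℝ), (K (x - y) - K (x + y)) * w y := by
  rw [integral_eq_integral_Ioi_add (hK.integrable_mul hw hM x)]
  congr 1; ext y
  rw [hodd, sub_neg_eq_add]; ring

/-- A lower bound for the convolution of the kernel with an odd function at a point where the
function has a negative minimum over the half-line. -/
lemma IsCuspKernel.mul_integral_le_of_min {w : ℝ → ℝ} (hw : Continuous w) {M : ℝ}
    (hM : ∀ y, |w y| ≤ M) (hodd : ∀ y, w (-y) = -w y) {x : ℝ} (hx : 0 < x) (hwx : w x < 0)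
    (hmin : ∀ y, 0 < y → w x ≤ w y) :
    w x * ∫ y in {y | 0 < y ∧ w y < 0}, K (x - y) ≤ ∫ y, K (x - y) * w y := by
  have hmeas : MeasurableSet {y | 0 < y ∧ w y < 0} :=
    ((isOpen_lt continuous_const continuous_id).inter
      (isOpen_lt hw continuous_const)).measurableSet
  have hsub : {y | 0 < y ∧ w y < 0} ⊆ Ioi 0 := fun y hy => hy.1
  rw [hK.integral_mul_odd hw hM hodd x, ← integral_const_mul,
    ← integral_indicator hmeas, ← integral_indicator measurableSet_Ioi]
  refine integral_mono_ae (((hK.integrable.comp_sub_left x).const_mul _).indicator hmeas)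
    ((integrable_indicator_iff measurableSet_Ioi).2 (hK.integrableOn_diff_mul hw hM x)) ?_
  have h1 : ∀ᵐ y : ℝ, y ≠ x := by rw [ae_iff]; simp
  filter_upwards [h1] with y hy
  by_cases hy0 : 0 < y
  · have hG := hK.diff_pos hx hy0 hy
    rw [indicator_of_mem (show y ∈ Ioi 0 from hy0)]
    by_cases hwy : w y < 0
    · rw [indicator_of_mem (show y ∈ {y | 0 < y ∧ w y < 0} from ⟨hy0, hwy⟩)]
      -- Replacing `w y` by the minimum `w x` and then dropping `K (x + y)` both decrease the
      -- integrand, the latter because `w x < 0`.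
      have h2 := hmin y hy0
      have h3 := hK.pos (x + y) (by positivity)
      nlinarith
    · rw [indicator_of_notMem (fun h => hwy h.2)]
      exact mul_nonneg hG.le (not_lt.1 hwy)
  · rw [indicator_of_notMem (fun h => hy0 h.1),
      indicator_of_notMem (show y ∉ Ioi 0 from hy0)]

lemma IsCuspKernel.nonneg_ae (x : ℝ) : ∀ᵐ y : ℝ, 0 ≤ K (x - y) := by
  have h1 : ∀ᵐ y : ℝ, y ≠ x := by rw [ae_iff]; simp
  filter_upwards [h1] with y hy using (hK.pos _ (sub_ne_zero.2 hy.symm)).le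

lemma IsCuspKernel.setIntegral_le_one (S : Set ℝ) (x : ℝ) : ∫ y in S, K (x - y) ≤ 1 := by
  refine (setIntegral_le_integral (hK.integrable.comp_sub_left x) (hK.nonneg_ae x)).trans ?_
  rw [integral_sub_left_eq_self K volume x]
  exact hK.integral_le_one

lemma IsCuspKernel.integral_mul_odd_pos {w : ℝ → ℝ} (hw : Continuous w) {M : ℝ}
    (hM : ∀ y, |w y| ≤ M) (hodd : ∀ y, w (-y) = -w y) (hnonneg : ∀ y, 0 < y → 0 ≤ w y)
    {y₁ : ℝ} (hy₁ : 0 < y₁) (hpos : 0 < w y₁) {x : ℝ} (hx : 0 < x) :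
    0 < ∫ y, K (x - y) * w y := by
  have h1 : ∀ᵐ y : ℝ, y ≠ x := by rw [ae_iff]; simp
  rw [hK.integral_mul_odd hw hM hodd x,
    setIntegral_pos_iff_support_of_nonneg_ae _ (hK.integrableOn_diff_mul hw hM x)]
  · have hU : 0 < volume ({y | 0 < y ∧ 0 < w y} ∩ {x}ᶜ) := by
      have ho' : IsOpen {y | 0 < y ∧ 0 < w y} :=
        (isOpen_lt continuous_const continuous_id).inter (isOpen_lt continuous_const hw)
      have h2 := ho'.measure_pos volume ⟨y₁, hy₁, hpos⟩
      rw [← sdiff_eq, measure_sdiff_null (measure_singleton x)]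
      exact h2
    refine hU.trans_le (measure_mono fun y hy => ⟨?_, hy.1.1⟩)
    exact (mul_pos (hK.diff_pos hx hy.1.1 hy.2) hy.1.2).ne'
  · filter_upwards [ae_restrict_mem measurableSet_Ioi, ae_restrict_of_ae h1] with y hy hyx
    exact mul_nonneg (hK.diff_pos hx hy hyx).le (hnonneg y hy)

end

/-! ### Non-existence of an asymmetric cusp -/

lemma integral_Ioi_comp_sub_rpow {a : ℝ} (ha : a < -1) {x : ℝ} (hx : 0 < x) :
    IntegrableOn (fun y => (y - x) ^ a) (Ioi (2 * x)) ∧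
      ∫ y in Ioi (2 * x), (y - x) ^ a = -x ^ (a + 1) / (a + 1) := by
  have h1 : MeasurePreserving (fun y : ℝ => y - x) volume volume := measurePreserving_sub_right _ x
  have h2 : MeasurableEmbedding (fun y : ℝ => y - x) := measurableEmbedding_subRight x
  have h3 : (fun y : ℝ => y - x) ⁻¹' Ioi x = Ioi (2 * x) := by
    ext y; simp only [mem_preimage, mem_Ioi]; constructor <;> intro h <;> linarith
  constructor
  · have := (h1.integrableOn_comp_preimage h2 (f := fun t => t ^ a) (s := Ioi x)).2
      (integrableOn_Ioi_rpow_of_lt ha hx)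
    rw [h3] at this
    exact this
  · have := h1.setIntegral_preimage_emb h2 (fun t => t ^ a) (Ioi x)
    rw [h3] at this
    rw [this, integral_Ioi_rpow_of_lt ha hx]

section
variable {K : ℝ → ℝ} (hK : IsCuspKernel K)
include hK

lemma IsCuspKernel.integral_Ioc_le {C : ℝ} (hC : ∀ x, 0 < x → K x ≤ C * x ^ (-(1 / 2) : ℝ))
    {x : ℝ} (hx : 0 < x) : ∫ y in Ioc 0 (2 * x), K (x - y) ≤ 4 * C * Real.sqrt x := by
  have hKi : ∀ a b, IntervalIntegrable K volume a b := fun a b => hK.integrable.intervalIntegrable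
  have h1 : ∫ y in Ioc 0 (2 * x), K (x - y) = ∫ y in (-x)..x, K y := by
    rw [← intervalIntegral.integral_of_le (by linarith), intervalIntegral.integral_comp_sub_left]
    congr 1 <;> ring
  have h2 : ∫ y in (-x)..0, K y = ∫ y in (0 : ℝ)..x, K y := by
    rw [← neg_zero, ← intervalIntegral.integral_comp_neg, neg_zero]
    simp only [hK.even]
  have h3 : ∫ y in (0 : ℝ)..x, K y ≤ 2 * C * Real.sqrt x := by
    calc ∫ y in (0 : ℝ)..x, K y ≤ ∫ y in (0 : ℝ)..x, C * y ^ (-(1 / 2) : ℝ) :=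
          intervalIntegral.integral_mono_on_of_le_Ioo hx.le (hKi _ _)
            ((intervalIntegral.intervalIntegrable_rpow' (by norm_num)).const_mul _)
            fun y hy => hC y hy.1
      _ = _ := by
          rw [intervalIntegral.integral_const_mul, integral_rpow (Or.inl (by norm_num)),
            Real.sqrt_eq_rpow]
          norm_num
          ring
  rw [h1, ← intervalIntegral.integral_add_adjacent_intervals (hKi (-x) 0) (hKi 0 x), h2]
  linarith

lemma IsCuspKernel.integral_even_sub {e : ℝ → ℝ} (he : Continuous e) {B : ℝ}
    (hB : ∀ y, |e y| ≤ B) (heven : ∀ y, e (-y) = e y) (x : ℝ) :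
    IntegrableOn (fun y => (K (x - y) + K (x + y) - 2 * K y) * e y) (Ioi 0) ∧
    (∫ y, K (x - y) * e y) - ∫ y, K (0 - y) * e y =
      ∫ y in Ioi (0 : ℝ), (K (x - y) + K (x + y) - 2 * K y) * e y := by
  have h1 := hK.integrable_mul he hB x
  have h2 := hK.integrable_mul he hB (0 : ℝ)
  have h3 : Integrable fun y => K (x - y) * e y - K (0 - y) * e y := h1.sub h2
  have h4 : ∀ y, (K (x - y) * e y - K (0 - y) * e y) + (K (x - -y) * e (-y) - K (0 - -y) * e (-y)) =
      (K (x - y) + K (x + y) - 2 * K y) * e y := fun y => by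
    rw [heven, sub_neg_eq_add, sub_neg_eq_add, zero_sub, hK.even, zero_add]; ring
  constructor
  · refine (h3.add h3.comp_neg).integrableOn.congr (Eventually.of_forall fun y => ?_)
    exact h4 y
  · rw [← integral_sub h1 h2, integral_eq_integral_Ioi_add h3]
    exact integral_congr_ae (Eventually.of_forall fun y => h4 y)

/-- The gain is that a square-root bound on `e` with constant `M` controls the increment linearly in
`M` and in `x + ε`. On `(0, 2x]` only `K (x - y)` is kept, of mass `O(√x)`; beyond `2x` the second
difference of the kernel supplies the factor `x²`. -/
lemma IsCuspKernel.even_sub_le_of_le_sqrt {C₁ C₂ : ℝ} (hC₁ : 0 < C₁)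
    (h₁ : ∀ x, 0 < x → K x ≤ C₁ * x ^ (-(1 / 2) : ℝ)) (hC₂ : 0 < C₂)
    (h₂ : ∀ x y, 0 < x → x < y →
      K (y - x) - 2 * K y + K (y + x) ≤ C₂ * x ^ 2 * (y - x) ^ (-(5 / 2) : ℝ))
    {e : ℝ → ℝ} (he : Continuous e) {B : ℝ} (hB : ∀ y, |e y| ≤ B)
    (heven : ∀ y, e (-y) = e y) (hpos : ∀ y, 0 < y → 0 ≤ e y)
    {ε M : ℝ} (hε : 0 < ε) (hM : 0 ≤ M) (hle : ∀ y, 0 < y → e y ≤ M * Real.sqrt (y + ε))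
    {x : ℝ} (hx : 0 < x) :
    (∫ y, K (x - y) * e y) - ∫ y, K (0 - y) * e y ≤ M * (8 * C₁ + 3 * C₂) * (x + ε) := by
  obtain ⟨hi, heq⟩ := hK.integral_even_sub he hB heven x
  have hne : ∀ᵐ y : ℝ, y ≠ x := by rw [ae_iff]; simp
  rw [heq, ← Ioc_union_Ioi_eq_Ioi (show (0 : ℝ) ≤ 2 * x by linarith),
    setIntegral_union (Ioc_disjoint_Ioi le_rfl) measurableSet_Ioi
      (hi.mono_set Ioc_subset_Ioi_self) (hi.mono_set (Ioi_subset_Ioi (by linarith)))]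
  have hsx := Real.sqrt_nonneg x
  have hsε := Real.sqrt_nonneg ε
  have hsx2 := Real.sq_sqrt hx.le
  have hsε2 := Real.sq_sqrt hε.le
  have I1 : ∫ y in Ioc 0 (2 * x), (K (x - y) + K (x + y) - 2 * K y) * e y ≤
      M * (8 * C₁) * (x + ε) := by
    calc _ ≤ ∫ y in Ioc 0 (2 * x), (M * Real.sqrt (2 * x + ε)) * K (x - y) := by
          refine setIntegral_mono_on_ae (hi.mono_set Ioc_subset_Ioi_self)
            ((hK.integrable.comp_sub_left x).const_mul _).integrableOn measurableSet_Ioc ?_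
          filter_upwards [hne] with y hy hy'
          have hy0 : 0 < y := hy'.1
          have h3 : K (x + y) < K y := hK.anti _ _ hy0 (by linarith)
          have h4 := hK.pos y hy0.ne'
          have h5 := hK.pos (x - y) (sub_ne_zero.2 hy.symm)
          have h6 : e y ≤ M * Real.sqrt (2 * x + ε) := (hle y hy0).trans
            (mul_le_mul_of_nonneg_left (Real.sqrt_le_sqrt (by linarith [hy'.2])) hM)
          rw [mul_comm]
          calc e y * (K (x - y) + K (x + y) - 2 * K y) ≤ e y * K (x - y) :=
                mul_le_mul_of_nonneg_left (by linarith) (hpos y hy0)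
            _ ≤ _ := mul_le_mul_of_nonneg_right h6 h5.le
      _ ≤ (M * Real.sqrt (2 * x + ε)) * (4 * C₁ * Real.sqrt x) := by
          rw [integral_const_mul]
          exact mul_le_mul_of_nonneg_left (hK.integral_Ioc_le h₁ hx) (by positivity)
      _ = M * (4 * C₁) * (Real.sqrt (2 * x + ε) * Real.sqrt x) := by ring
      _ ≤ M * (4 * C₁) * (2 * (x + ε)) := by
          refine mul_le_mul_of_nonneg_left ?_ (by positivity)
          have h7 := Real.sq_sqrt (show 0 ≤ 2 * x + ε by linarith)
          nlinarith [sq_nonneg (Real.sqrt (2 * x + ε) - Real.sqrt x)]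
      _ = _ := by ring
  have I2 : ∫ y in Ioi (2 * x), (K (x - y) + K (x + y) - 2 * K y) * e y ≤
      M * (3 * C₂) * (x + ε) := by
    obtain ⟨i1, v1⟩ := integral_Ioi_comp_sub_rpow (a := -2) (by norm_num) hx
    obtain ⟨i2, v2⟩ := integral_Ioi_comp_sub_rpow (a := -(5 / 2)) (by norm_num) hx
    calc _ ≤ ∫ y in Ioi (2 * x), (M * C₂ * x ^ 2) *
            (2 * (y - x) ^ (-2 : ℝ) + Real.sqrt ε * (y - x) ^ (-(5 / 2) : ℝ)) := by
          refine setIntegral_mono_on (hi.mono_set (Ioi_subset_Ioi (by linarith)))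
            (((i1.const_mul 2).add (i2.const_mul (Real.sqrt ε))).const_mul _) measurableSet_Ioi
            fun y hy => ?_
          have hy' : 2 * x < y := hy
          have ht : 0 < y - x := by linarith
          have h3 := h₂ x y hx (by linarith)
          have h4 : K (x - y) = K (y - x) := by rw [← hK.even]; congr 1; ring
          -- From `y > 2x` it follows that `y < 2 (y - x)`, so everything is expressed through the
          -- variable of the integrable power.
          have h5 : e y ≤ M * (2 * Real.sqrt (y - x) + Real.sqrt ε) := by
            refine (hle y (by linarith)).trans (mul_le_mul_of_nonneg_left ?_ hM)
            have h6 := Real.sq_sqrt ht.le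
            have h7 := Real.sqrt_nonneg (y - x)
            rw [Real.sqrt_le_left (by positivity)]
            nlinarith
          rw [h4, add_comm x y]
          calc (K (y - x) + K (y + x) - 2 * K y) * e y
              ≤ (C₂ * x ^ 2 * (y - x) ^ (-(5 / 2) : ℝ)) * e y :=
                mul_le_mul_of_nonneg_right (by linarith) (hpos y (by linarith))
            _ ≤ (C₂ * x ^ 2 * (y - x) ^ (-(5 / 2) : ℝ)) *
                  (M * (2 * Real.sqrt (y - x) + Real.sqrt ε)) := by gcongr
            _ = (M * C₂ * x ^ 2) * (2 * ((y - x) ^ (-(5 / 2) : ℝ) * Real.sqrt (y - x)) +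
                  Real.sqrt ε * (y - x) ^ (-(5 / 2) : ℝ)) := by ring
            _ = _ := by
                rw [Real.sqrt_eq_rpow (y - x), ← Real.rpow_add ht]
                norm_num
      _ = (M * C₂ * x ^ 2) * (2 * x⁻¹ + Real.sqrt ε * (2 / 3 * x ^ (-(3 / 2) : ℝ))) := by
          rw [integral_const_mul, integral_add (i1.const_mul 2) (i2.const_mul _),
            integral_const_mul, integral_const_mul, v1, v2]
          norm_num [Real.rpow_neg_one]
          left; left; ring
      _ = (M * C₂) * (2 * x + 2 / 3 * (Real.sqrt ε * Real.sqrt x)) := by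
          have h8 : x ^ 2 * x ^ (-(3 / 2) : ℝ) = Real.sqrt x := by
            rw [← Real.rpow_natCast, ← Real.rpow_add hx, Real.sqrt_eq_rpow]; norm_num
          rw [← h8]
          field_simp
      _ ≤ (M * C₂) * (3 * (x + ε)) := by
          refine mul_le_mul_of_nonneg_left ?_ (by positivity)
          nlinarith [sq_nonneg (Real.sqrt ε - Real.sqrt x)]
      _ = _ := by ring
  linarith

/-- The even and odd parts of `c / 2 - φ` at an asymmetric maximum of height `c / 2` would satisfy
the hypotheses of this lemma, which contradict each other. -/
theorem IsCuspKernel.no_asymmetric_cusp {e p : ℝ → ℝ} (he : Continuous e) (hp : Continuous p)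
    {B : ℝ} (hB : ∀ y, |e y| ≤ B) {B' : ℝ} (hB' : ∀ y, |p y| ≤ B')
    (heven : ∀ y, e (-y) = e y) (hodd : ∀ y, p (-y) = -p y)
    (hepos : ∀ y, 0 < y → 0 < e y) (hppos : ∀ y, 0 < y → 0 < p y)
    (h_odd_eq : ∀ x, 0 < x → 2 * e x * p x = ∫ y, K (x - y) * p y)
    (h_even_eq : ∀ x, 0 < x →
      e x ^ 2 + p x ^ 2 = (∫ y, K (x - y) * e y) - ∫ y, K (0 - y) * e y) : False := by
  obtain ⟨C₁, hC₁, h₁⟩ := hK.le_rpow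
  obtain ⟨C₂, hC₂, h₂⟩ := hK.second_diff_le
  obtain ⟨κ, hκ, h₃⟩ := hK.le_diff
  set Q := 8 * C₁ + 3 * C₂ with hQ
  have hQ0 : 0 < Q := by positivity
  have hB0 : 0 ≤ B := (abs_nonneg _).trans (hB 0)
  have step : ∀ ε M : ℝ, 0 < ε → 0 ≤ M → (∀ y, 0 < y → e y ≤ M * Real.sqrt (y + ε)) →
      ∀ x, 0 < x → e x ^ 2 + p x ^ 2 ≤ M * Q * (x + ε) := fun ε M hε hM hle x hx => by
    rw [h_even_eq x hx]
    exact hK.even_sub_le_of_le_sqrt hC₁ h₁ hC₂ h₂ he hB heven (fun y hy => (hepos y hy).le) hε hM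
      hle hx
  -- Bootstrap: the shift by `ε` makes the best constant `M` in `e ≤ M √(y + ε)` finite a priori.
  -- The increment estimate then gives `M² ≤ M Q`, hence `M ≤ Q` independently of `ε`.
  have bound : ∀ ε : ℝ, 0 < ε → ∀ x, 0 < x → e x ^ 2 + p x ^ 2 ≤ Q ^ 2 * (x + ε) := by
    intro ε hε
    set f : Ioi (0 : ℝ) → ℝ := fun y => e y / Real.sqrt (y + ε) with hf
    have hbdd : BddAbove (range f) := by
      refine ⟨B / Real.sqrt ε, ?_⟩
      rintro _ ⟨⟨y, hy⟩, rfl⟩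
      have hy0 : 0 < y := hy
      simp only [hf]
      gcongr
      · exact (le_abs_self _).trans (hB y)
      · linarith
    set M := ⨆ y, f y with hMdef
    have hfpos : ∀ y, 0 < f y := fun ⟨y, hy⟩ => by
      have hy0 : 0 < y := hy
      have := hepos y hy
      simp only [hf]
      positivity
    have hM : 0 ≤ M := (hfpos ⟨1, mem_Ioi.2 one_pos⟩).le.trans (le_ciSup hbdd _)
    have hle : ∀ y, 0 < y → e y ≤ M * Real.sqrt (y + ε) := fun y hy => by
      have := le_ciSup hbdd ⟨y, hy⟩
      rwa [hf, div_le_iff₀ (Real.sqrt_pos.2 (by linarith))] at this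
    have hMQ : M ≤ Q := by
      have h4 : M ≤ Real.sqrt (M * Q) := by
        have : Nonempty (Ioi (0 : ℝ)) := ⟨⟨1, mem_Ioi.2 one_pos⟩⟩
        refine ciSup_le fun ⟨y, hy⟩ => ?_
        have hy0 : 0 < y := hy
        simp only [hf]
        rw [div_le_iff₀ (Real.sqrt_pos.2 (by linarith)), ← Real.sqrt_mul (by positivity)]
        refine Real.le_sqrt_of_sq_le ?_
        have := step ε M hε hM hle y hy0
        nlinarith [sq_nonneg (p y)]
      have h5 : M ^ 2 ≤ M * Q := (Real.le_sqrt hM (by positivity)).1 h4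
      rcases hM.eq_or_lt with h | h
      · rw [← h]; exact hQ0.le
      · exact le_of_mul_le_mul_left (by rwa [← sq]) h
    intro x hx
    refine (step ε M hε hM hle x hx).trans ?_
    rw [sq]
    gcongr
  have bound0 : ∀ x, 0 < x → e x ^ 2 + p x ^ 2 ≤ Q ^ 2 * x := by
    intro x hx
    have h4 : Tendsto (fun ε : ℝ => Q ^ 2 * (x + ε)) (𝓝[>] 0) (𝓝 (Q ^ 2 * (x + 0))) :=
      (Continuous.tendsto (by fun_prop) 0).mono_left nhdsWithin_le_nhds
    rw [add_zero] at h4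
    refine ge_of_tendsto h4 ?_
    filter_upwards [self_mem_nhdsWithin] with ε hε using bound ε hε x hx
  -- All contributions to the odd convolution are nonnegative, so any window `(a, b]` to the right
  -- of `x` gives a lower bound. It is used twice: on `(1/2, 1]` and on `(x, 1/2]`.
  have lower : ∀ x a b : ℝ, 0 < x → x ≤ a → a ≤ b → b ≤ 1 →
      κ * x * ∫ y in Ioc a b, y ^ (-(3 / 2) : ℝ) * p y ≤ 2 * e x * p x := by
    intro x a b hx hxa hab hb
    have ha : 0 < a := hx.trans_le hxa
    rw [h_odd_eq x hx, hK.integral_mul_odd hp hB' hodd x, ← integral_const_mul]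
    have hi := hK.integrableOn_diff_mul hp hB' x
    have hsub : Ioc a b ⊆ Ioi 0 := fun y hy => ha.trans hy.1
    have hci : IntegrableOn (fun y => κ * x * (y ^ (-(3 / 2) : ℝ) * p y)) (Ioc a b) := by
      refine (ContinuousOn.integrableOn_Icc ?_).mono_set Ioc_subset_Icc_self
      refine continuousOn_const.mul (ContinuousOn.mul ?_ hp.continuousOn)
      exact ContinuousOn.rpow_const continuousOn_id fun y hy => Or.inl (ha.trans_le hy.1).ne'
    refine (setIntegral_mono_on hci (hi.mono_set hsub) measurableSet_Ioc fun y hy => ?_).trans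
      (setIntegral_mono_set hi ?_ (LE.le.eventuallyLE hsub))
    · have hxy : x < y := hxa.trans_lt hy.1
      have h4 := h₃ x y hx hxy (hy.2.trans hb)
      have h5 : K (x - y) = K (y - x) := by rw [← hK.even]; congr 1; ring
      rw [h5, add_comm x y, ← mul_assoc]
      exact mul_le_mul_of_nonneg_right h4 (hppos y (hx.trans hxy)).le
    · have hne : ∀ᵐ y : ℝ, y ≠ x := by rw [ae_iff]; simp
      filter_upwards [ae_restrict_mem measurableSet_Ioi, ae_restrict_of_ae hne] with y hy hyx
      exact mul_nonneg (hK.diff_pos hx hy hyx).le (hppos y hy).le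
  obtain ⟨y₀, hy₀, hmin⟩ := isCompact_Icc.exists_isMinOn (nonempty_Icc.2 (by norm_num : (1 / 2 : ℝ) ≤ 1))
    hp.continuousOn
  have hp₀ : 0 < p y₀ := hppos y₀ (lt_of_lt_of_le (by norm_num) hy₀.1)
  have hint : p y₀ / 2 ≤ ∫ y in Ioc (1 / 2 : ℝ) 1, y ^ (-(3 / 2) : ℝ) * p y := by
    have hci : IntegrableOn (fun y : ℝ => y ^ (-(3 / 2) : ℝ) * p y) (Ioc (1 / 2) 1) := by
      refine (ContinuousOn.integrableOn_Icc ?_).mono_set Ioc_subset_Icc_self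
      refine ContinuousOn.mul ?_ hp.continuousOn
      exact ContinuousOn.rpow_const continuousOn_id fun y hy =>
        Or.inl (lt_of_lt_of_le (by norm_num) hy.1).ne'
    calc p y₀ / 2 = ∫ y in Ioc (1 / 2 : ℝ) 1, p y₀ := by
          rw [setIntegral_const, measureReal_def, Real.volume_Ioc]
          norm_num
          ring
      _ ≤ _ := by
          refine setIntegral_mono_on (integrableOn_const (by simp)) hci measurableSet_Ioc
            fun y hy => ?_
          have hy0 : 0 < y := lt_trans (by norm_num) hy.1
          have h4 : p y₀ ≤ p y := hmin ⟨hy.1.le, hy.2⟩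
          have h5 : 1 ≤ y ^ (-(3 / 2) : ℝ) :=
            Real.one_le_rpow_of_pos_of_le_one_of_nonpos hy0 hy.2 (by norm_num)
          nlinarith
  set c₂ := κ * (p y₀ / 2) / (2 * Q) with hc₂
  have hc₂0 : 0 < c₂ := by positivity
  have e_le : ∀ x, 0 < x → e x ≤ Q * Real.sqrt x := fun x hx => by
    have h4 := bound0 x hx
    refine abs_le_of_sq_le_sq' ?_ (by positivity) |>.2
    rw [mul_pow, Real.sq_sqrt hx.le]
    nlinarith [sq_nonneg (p x)]
  -- The fixed window bounds `2 e p` below by a multiple of `x`; division by `e ≤ Q √x` leaves `√x`.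
  have p_ge : ∀ x, 0 < x → x ≤ 1 / 2 → c₂ * Real.sqrt x ≤ p x := by
    intro x hx hx2
    have h4 := lower x (1 / 2) 1 hx hx2 (by norm_num) le_rfl
    have h5 := mul_le_mul_of_nonneg_left hint (show 0 ≤ κ * x by positivity)
    have h6 : 2 * e x * p x ≤ 2 * (Q * Real.sqrt x) * p x := by
      have := e_le x hx
      have := hppos x hx
      gcongr
    have hs : 0 < Real.sqrt x := Real.sqrt_pos.2 hx
    rw [hc₂, div_mul_eq_mul_div, div_le_iff₀ (by positivity)]
    refine le_of_mul_le_mul_right ?_ hs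
    calc κ * (p y₀ / 2) * Real.sqrt x * Real.sqrt x = κ * x * (p y₀ / 2) := by
          rw [mul_assoc _ (Real.sqrt x), Real.mul_self_sqrt hx.le]; ring
      _ ≤ 2 * (Q * Real.sqrt x) * p x := by linarith
      _ = _ := by ring
  -- With `p ≥ c₂ √y` the integrand on `(x, 1/2]` is at least `c₂ / y`, while `2 e p ≤ e² + p² ≤ Q²
  -- x`. The logarithm is unbounded as `x → 0`.
  have final : ∀ x, 0 < x → x ≤ 1 / 2 → κ * c₂ * (Real.log (1 / 2) - Real.log x) ≤ Q ^ 2 := by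
    intro x hx hx2
    have h4 := lower x x (1 / 2) hx le_rfl hx2 (by norm_num)
    have h5 : c₂ * (Real.log (1 / 2) - Real.log x) ≤
        ∫ y in Ioc x (1 / 2), y ^ (-(3 / 2) : ℝ) * p y := by
      have h0 : (0 : ℝ) ∉ uIcc x (1 / 2) := by
        rw [uIcc_of_le hx2]; exact fun h => absurd h.1 (not_le.2 hx)
      rw [← Real.log_div (by norm_num) hx.ne', ← integral_inv h0,
        ← intervalIntegral.integral_const_mul, intervalIntegral.integral_of_le hx2]
      refine setIntegral_mono_on ?_ ?_ measurableSet_Ioc fun y hy => ?_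
      · refine (ContinuousOn.integrableOn_Icc ?_).mono_set Ioc_subset_Icc_self
        exact continuousOn_const.mul (ContinuousOn.inv₀ continuousOn_id
          fun y hy => (hx.trans_le hy.1).ne')
      · refine (ContinuousOn.integrableOn_Icc ?_).mono_set Ioc_subset_Icc_self
        refine ContinuousOn.mul ?_ hp.continuousOn
        exact ContinuousOn.rpow_const continuousOn_id fun y hy => Or.inl (hx.trans_le hy.1).ne'
      · have hy0 : 0 < y := hx.trans hy.1
        have h6 := p_ge y hy0 hy.2
        calc c₂ * y⁻¹ = y ^ (-(3 / 2) : ℝ) * (c₂ * Real.sqrt y) := by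
              rw [Real.sqrt_eq_rpow, mul_left_comm, ← Real.rpow_add hy0, ← Real.rpow_neg_one]
              norm_num
          _ ≤ _ := by gcongr
    have h6 : 2 * e x * p x ≤ Q ^ 2 * x := by
      nlinarith [bound0 x hx, sq_nonneg (e x - p x)]
    have h7 := mul_le_mul_of_nonneg_left h5 (show 0 ≤ κ * x by positivity)
    refine le_of_mul_le_mul_right ?_ hx
    calc _ = κ * x * (c₂ * (Real.log (1 / 2) - Real.log x)) := by ring
      _ ≤ _ := by linarith
  -- At `x = exp (-T) / 2` the logarithmic gap equals `T`, so the left side exceeds `Q²` by exactly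
  -- `κ c₂`.
  set T := Q ^ 2 / (κ * c₂) + 1 with hT
  have hT0 : 0 < T := by positivity
  have h4 := final (1 / 2 * Real.exp (-T)) (by positivity) (by
    have : Real.exp (-T) ≤ 1 := Real.exp_le_one_iff.2 (by linarith)
    linarith)
  rw [Real.log_mul (by norm_num) (Real.exp_pos _).ne', Real.log_exp, sub_add_cancel_left, neg_neg,
    hT, mul_add, mul_div_cancel₀ _ (by positivity)] at h4
  have : 0 < κ * c₂ := by positivity
  linarith

end

/-! ### Even and odd parts of a solution about a point -/

/-- Twice the odd part of `φ` about `a`. -/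
def oddPart (φ : ℝ → ℝ) (a y : ℝ) : ℝ := φ (a + y) - φ (a - y)

/-- Twice the even part of `φ` about `a`. -/
def evenPart (φ : ℝ → ℝ) (a y : ℝ) : ℝ := φ (a + y) + φ (a - y)

lemma oddPart_neg (φ : ℝ → ℝ) (a y : ℝ) : oddPart φ a (-y) = -oddPart φ a y := by
  simp [oddPart, sub_eq_add_neg]

lemma evenPart_neg (φ : ℝ → ℝ) (a y : ℝ) : evenPart φ a (-y) = evenPart φ a y := by
  simp [evenPart, sub_eq_add_neg, add_comm]

lemma badSet_eq_empty_iff {φ : ℝ → ℝ} {a : ℝ} :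
    badSet φ a = ∅ ↔ ∀ y, 0 < y → 0 ≤ oddPart φ a y := by
  rw [eq_empty_iff_forall_notMem]
  constructor
  · intro h y hy
    have h1 := h (a + y)
    simp only [badSet, halfLine, reflect, mem_ofPred_eq, not_and, not_lt] at h1
    have h2 := h1 (by linarith)
    rw [show 2 * a - (a + y) = a - y by ring] at h2
    exact sub_nonneg.2 h2
  · rintro h x ⟨hx, hlt⟩
    have h1 := h (x - a) (sub_pos.2 hx)
    simp only [oddPart, reflect] at h1 hlt
    rw [show a + (x - a) = x by ring, show a - (x - a) = 2 * a - x by ring] at h1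
    linarith

section
variable {c : ℝ} {φ : ℝ → ℝ} (hφ : IsSteadySolution c φ)
include hφ

lemma IsSteadySolution.eq_integral (x : ℝ) :
    c * φ x - φ x ^ 2 = ∫ y, kernel (x - y) * φ y := by
  have h1 := hφ.equation x
  have h2 : conv kernel φ x = ∫ y, kernel (x - y) * φ y := by
    rw [conv]
    exact convolution_mul_swap
  rw [h2] at h1
  linarith

lemma IsSteadySolution.integral_add (a x : ℝ) :
    ∫ y, kernel (x - y) * φ (a + y) = c * φ (a + x) - φ (a + x) ^ 2 := by
  rw [hφ.eq_integral, ← integral_add_left_eq_self (fun y => kernel (a + x - y) * φ y) a]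
  congr 1; ext y
  congr 2; ring

lemma IsSteadySolution.integral_sub (a x : ℝ) :
    ∫ y, kernel (x - y) * φ (a - y) = c * φ (a - x) - φ (a - x) ^ 2 := by
  rw [hφ.eq_integral, ← integral_sub_left_eq_self (fun y => kernel (a - x - y) * φ y) volume a]
  congr 1; ext y
  congr 1
  rw [← kernel_neg]
  congr 1; ring

lemma IsSteadySolution.integrable_add (a x : ℝ) :
    Integrable fun y => kernel (x - y) * φ (a + y) := by
  obtain ⟨M, hM⟩ := hφ.bounded
  have := hφ.continuous
  exact isCuspKernel_kernel.integrable_mul (by fun_prop) (fun y => hM _) x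

lemma IsSteadySolution.integrable_sub (a x : ℝ) :
    Integrable fun y => kernel (x - y) * φ (a - y) := by
  obtain ⟨M, hM⟩ := hφ.bounded
  have := hφ.continuous
  exact isCuspKernel_kernel.integrable_mul (by fun_prop) (fun y => hM _) x

/-- The nonlinearity factors, since the difference of the two squares is `evenPart * oddPart`. The
equation is thus linear in the odd part with coefficient `c - evenPart`. -/
lemma IsSteadySolution.odd_eq (a x : ℝ) :
    (c - evenPart φ a x) * oddPart φ a x = ∫ y, kernel (x - y) * oddPart φ a y := by
  have h1 := MeasureTheory.integral_sub (hφ.integrable_add a x) (hφ.integrable_sub a x)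
  rw [hφ.integral_add, hφ.integral_sub] at h1
  simp only [oddPart, evenPart, mul_sub]
  rw [h1]; ring

lemma IsSteadySolution.even_eq (a x : ℝ) :
    c * evenPart φ a x - (evenPart φ a x ^ 2 + oddPart φ a x ^ 2) / 2 =
      ∫ y, kernel (x - y) * evenPart φ a y := by
  have h1 := MeasureTheory.integral_add (hφ.integrable_add a x) (hφ.integrable_sub a x)
  rw [hφ.integral_add, hφ.integral_sub] at h1
  simp only [oddPart, evenPart, mul_add]
  rw [h1]; ring

lemma IsSteadySolution.continuous_oddPart (a : ℝ) : Continuous (oddPart φ a) := by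
  have := hφ.continuous
  unfold oddPart; fun_prop

lemma IsSteadySolution.continuous_evenPart (a : ℝ) : Continuous (evenPart φ a) := by
  have := hφ.continuous
  unfold evenPart; fun_prop

lemma IsSteadySolution.exists_bound_parts :
    ∃ M : ℝ, ∀ a y, |oddPart φ a y| ≤ M ∧ |evenPart φ a y| ≤ M := by
  obtain ⟨M, hM⟩ := hφ.bounded
  refine ⟨M + M, fun a y => ⟨?_, ?_⟩⟩
  · exact (abs_sub _ _).trans (add_le_add (hM _) (hM _))
  · exact (abs_add_le _ _).trans (add_le_add (hM _) (hM _))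

/-! ### Positivity -/

/-- At a negative minimum, kernel mass at most 1 gives `c φ - φ² ≥ φ`, that is `(c - 1) φ ≥ φ²`,
which is impossible. -/
lemma IsSteadySolution.nonneg (hc : 1 < c) (h0 : Tendsto φ (cocompact ℝ) (𝓝 0)) (x : ℝ) :
    0 ≤ φ x := by
  by_contra! hx
  obtain ⟨x₀, hmin⟩ := hφ.continuous.exists_forall_le' x
    ((h0.eventually (lt_mem_nhds hx)).mono fun _ => le_of_lt)
  have hneg : φ x₀ < 0 := (hmin x).trans_lt hx
  have hK := isCuspKernel_kernel
  obtain ⟨M, hM⟩ := hφ.bounded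
  have h1 : φ x₀ * ∫ y, kernel (x₀ - y) ≤ ∫ y, kernel (x₀ - y) * φ y := by
    rw [← integral_const_mul]
    refine integral_mono_ae ((hK.integrable.comp_sub_left x₀).const_mul _)
      (hK.integrable_mul hφ.continuous hM x₀) ?_
    filter_upwards [hK.nonneg_ae x₀] with y hy
    rw [mul_comm]
    exact mul_le_mul_of_nonneg_left (hmin y) hy
  rw [integral_sub_left_eq_self kernel volume x₀, ← hφ.eq_integral] at h1
  nlinarith [hK.integral_le_one, sq_nonneg (φ x₀)]

lemma IsSteadySolution.pos (hc : 1 < c) (hne : φ ≠ 0) (h0 : Tendsto φ (cocompact ℝ) (𝓝 0))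
    (x : ℝ) : 0 < φ x := by
  have hnn := hφ.nonneg hc h0
  have hK := isCuspKernel_kernel
  obtain ⟨M, hM⟩ := hφ.bounded
  obtain ⟨y₁, hy₁⟩ : ∃ y, φ y ≠ 0 := by
    by_contra! h
    exact hne (funext h)
  have h1 : 0 < ∫ y, kernel (x - y) * φ y := by
    rw [integral_pos_iff_support_of_nonneg_ae _ (hK.integrable_mul hφ.continuous hM x)]
    · have ho : IsOpen {y | φ y ≠ 0} := isOpen_ne_fun hφ.continuous continuous_const
      have h2 := ho.measure_pos volume ⟨y₁, hy₁⟩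
      rw [← measure_sdiff_null (measure_singleton x)] at h2
      refine h2.trans_le (measure_mono fun y hy => mul_ne_zero ?_ hy.1)
      exact (hK.pos _ (sub_ne_zero.2 (Ne.symm hy.2))).ne'
    · filter_upwards [hK.nonneg_ae x] with y hy using mul_nonneg hy (hnn y)
  rw [← hφ.eq_integral] at h1
  rcases (hnn x).eq_or_lt with h | h
  · rw [← h] at h1; simp at h1
  · exact h

/-! ### The moving plane -/

/-- The odd part tends to zero at infinity and vanishes at `0`, so a negative infimum is attained in
the interior. -/
lemma IsSteadySolution.exists_min_oddPart (h0 : Tendsto φ (cocompact ℝ) (𝓝 0)) {a y₁ : ℝ}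
    (hy₁ : 0 < y₁) (hneg : oddPart φ a y₁ < 0) :
    ∃ x, 0 < x ∧ oddPart φ a x < 0 ∧ ∀ y, 0 < y → oddPart φ a x ≤ oddPart φ a y := by
  have h1 : Tendsto (oddPart φ a) (cocompact ℝ) (𝓝 0) := by
    have e1 := h0.comp (Homeomorph.addLeft a).isClosedEmbedding.tendsto_cocompact
    have e2 := h0.comp (Homeomorph.subLeft a).isClosedEmbedding.tendsto_cocompact
    have := e1.sub e2
    rw [sub_zero] at this
    exact this
  obtain ⟨x, hx, hmin⟩ := (hφ.continuous_oddPart a).continuousOn.exists_isMinOn' isClosed_Ici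
    (mem_Ici.2 hy₁.le)
    (((h1.eventually (lt_mem_nhds hneg)).mono fun _ => le_of_lt).filter_mono inf_le_left)
  have hle : oddPart φ a x < 0 := lt_of_le_of_lt (hmin (mem_Ici.2 hy₁.le)) hneg
  refine ⟨x, lt_of_le_of_ne hx ?_, hle, fun y hy => hmin (mem_Ici.2 hy.le)⟩
  rintro rfl
  simp [oddPart] at hle

lemma IsSteadySolution.sub_evenPart_le {a x : ℝ} (hx : 0 < x) (hneg : oddPart φ a x < 0)
    (hmin : ∀ y, 0 < y → oddPart φ a x ≤ oddPart φ a y) :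
    c - evenPart φ a x ≤ ∫ y in {y | 0 < y ∧ oddPart φ a y < 0}, kernel (x - y) := by
  obtain ⟨M, hM⟩ := hφ.exists_bound_parts
  have h1 := isCuspKernel_kernel.mul_integral_le_of_min (hφ.continuous_oddPart a)
    (fun y => (hM a y).1) (oddPart_neg φ a) hx hneg hmin
  rw [← hφ.odd_eq] at h1
  by_contra! hlt
  have h2 := mul_lt_mul_of_neg_left hlt hneg
  linarith

lemma IsSteadySolution.sub_evenPart_le_one {a x : ℝ} (hx : 0 < x) (hneg : oddPart φ a x < 0)
    (hmin : ∀ y, 0 < y → oddPart φ a x ≤ oddPart φ a y) : c - evenPart φ a x ≤ 1 :=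
  (hφ.sub_evenPart_le hx hneg hmin).trans (isCuspKernel_kernel.setIntegral_le_one _ x)

lemma IsSteadySolution.exists_badSet_eq_empty (hc : 1 < c) (h0 : Tendsto φ (cocompact ℝ) (𝓝 0))
    (hbot : Tendsto φ atBot (𝓝 0)) : ∃ N : ℝ, 0 < N ∧ ∀ a ≤ -N, badSet φ a = ∅ := by
  obtain ⟨b, hb⟩ := (hbot.eventually (gt_mem_nhds (show (0 : ℝ) < (c - 1) / 2 by linarith))).exists_forall_of_atBot
  refine ⟨|b| + 1, by positivity, fun a ha => badSet_eq_empty_iff.2 fun y hy => ?_⟩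
  by_contra! hneg
  obtain ⟨x, hx, hxneg, hmin⟩ := hφ.exists_min_oddPart h0 hy hneg
  have h1 := hφ.sub_evenPart_le_one hx hxneg hmin
  -- A negative odd part makes `φ (a + x)` smaller still, so smallness on the left alone gives
  -- `evenPart < c - 1`.
  have h2 : φ (a - x) < (c - 1) / 2 := hb _ (by linarith [neg_abs_le b])
  simp only [oddPart, evenPart] at h1 hxneg
  linarith

lemma IsSteadySolution.oddPart_pos_and_evenPart_lt {a y₁ : ℝ}
    (hgood : ∀ y, 0 < y → 0 ≤ oddPart φ a y) (hy₁ : 0 < y₁) (hne : oddPart φ a y₁ ≠ 0)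
    {x : ℝ} (hx : 0 < x) : 0 < oddPart φ a x ∧ evenPart φ a x < c := by
  obtain ⟨M, hM⟩ := hφ.exists_bound_parts
  have h1 := isCuspKernel_kernel.integral_mul_odd_pos (hφ.continuous_oddPart a)
    (fun y => (hM a y).1) (oddPart_neg φ a) hgood hy₁ (lt_of_le_of_ne (hgood y₁ hy₁) hne.symm) hx
  rw [← hφ.odd_eq] at h1
  have h2 := hgood x hx
  have h3 : 0 < oddPart φ a x := lt_of_le_of_ne h2 fun h => by
    rw [← h, mul_zero] at h1; exact h1.false
  exact ⟨h3, by linarith [pos_of_mul_pos_left h1 h2]⟩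

lemma IsSteadySolution.two_mul_ne_of_oddPart_pos {a : ℝ}
    (h : ∀ x, 0 < x → 0 < oddPart φ a x ∧ evenPart φ a x < c) : 2 * φ a ≠ c := by
  intro hcusp
  obtain ⟨M, hM⟩ := hφ.exists_bound_parts
  have hK := isCuspKernel_kernel
  have hce := hφ.continuous_evenPart a
  have hco := hφ.continuous_oddPart a
  -- The constant `c / 2` contributes `c / 2 * ∫ kernel` at every point and cancels in the increment
  -- from `0`; the exact mass of the kernel is not needed.
  have hE : ∀ x, ∫ y, kernel (x - y) * ((c - evenPart φ a y) / 2) =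
      c / 2 * (∫ y, kernel y) -
        (c * evenPart φ a x - (evenPart φ a x ^ 2 + oddPart φ a x ^ 2) / 2) / 2 := by
    intro x
    have i1 := (hK.integrable.comp_sub_left x).const_mul (c / 2)
    have i2 := (hK.integrable_mul hce (fun y => (hM a y).2) x).const_mul (1 / 2)
    have := MeasureTheory.integral_sub i1 i2
    rw [integral_const_mul, integral_const_mul, ← hφ.even_eq,
      integral_sub_left_eq_self kernel volume x] at this
    calc _ = ∫ y, (c / 2 * kernel (x - y) - 1 / 2 * (kernel (x - y) * evenPart φ a y)) := by
          congr 1; ext y; ring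
      _ = _ := by rw [this]; ring
  refine hK.no_asymmetric_cusp (e := fun y => (c - evenPart φ a y) / 2)
    (p := fun y => oddPart φ a y / 2) (by fun_prop) (by fun_prop) (B := (|c| + M) / 2) ?_
    (B' := M / 2) ?_ ?_ ?_ ?_ ?_ ?_ ?_
  · intro y
    rw [abs_div, abs_two]
    have := (abs_sub c (evenPart φ a y)).trans (add_le_add_right (hM a y).2 |c|)
    linarith
  · intro y
    rw [abs_div, abs_two]
    linarith [(hM a y).1]
  · intro y; simp only [evenPart_neg]
  · intro y; simp only [oddPart_neg, neg_div]
  · intro y hy; linarith [(h y hy).2]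
  · intro y hy; linarith [(h y hy).1]
  · intro x _
    have h1 := hφ.odd_eq a x
    calc _ = (c - evenPart φ a x) * oddPart φ a x / 2 := by ring
      _ = (∫ y, kernel (x - y) * oddPart φ a y) / 2 := by rw [h1]
      _ = _ := by
          rw [← integral_div]
          congr 1; ext y; ring
  · intro x _
    rw [hE, hE]
    have h1 : evenPart φ a 0 = c := by rw [← hcusp, evenPart]; ring_nf
    have h2 : oddPart φ a 0 = 0 := by simp [oddPart]
    rw [h1, h2]
    ring

end

/-! ### Uniform smallness of kernel mass and the choice of the decay rate. -/

section
variable {K : ℝ → ℝ} (hK : IsCuspKernel K)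
include hK

/-- The mass that the kernel, centred at a small `x`, gives to a neighbourhood of the endpoint and
of infinity is small. -/
lemma IsCuspKernel.exists_small_mass {η : ℝ} (hη : 0 < η) (R : ℝ) :
    ∃ r₀ L : ℝ, 0 < r₀ ∧ R ≤ L ∧ ∀ r, 0 < r → r < r₀ → ∀ x, 0 < x → x < r →
      ∀ S : Set ℝ, MeasurableSet S → S ⊆ Ioc 0 r ∪ Ioi L → ∫ y in S, K (x - y) < η := by
  have hi : ∀ a b, IntervalIntegrable K volume a b := fun a b => hK.integrable.intervalIntegrable
  have hKnn : ∀ᵐ y : ℝ, 0 ≤ K y := ae_ne_zero.mono fun y hy => (hK.pos y hy).le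
  have h1 : Tendsto (fun r : ℝ => ∫ y in (-r)..r, K y) (𝓝 0) (𝓝 0) := by
    have hc := intervalIntegral.continuous_primitive hi 0
    have e1 : ∀ r : ℝ, ∫ y in (-r)..r, K y = (∫ y in (0 : ℝ)..r, K y) - ∫ y in (0 : ℝ)..(-r), K y :=
      fun r => (intervalIntegral.integral_interval_sub_left (hi 0 r) (hi 0 (-r))).symm
    simp only [e1]
    have hc2 : Continuous fun r : ℝ => (∫ y in (0 : ℝ)..r, K y) - ∫ y in (0 : ℝ)..(-r), K y :=
      hc.sub (hc.comp continuous_neg)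
    simpa using hc2.tendsto 0
  obtain ⟨r₁, hr₁, hr₁'⟩ := Metric.eventually_nhds_iff.1 (h1.eventually (gt_mem_nhds (half_pos hη)))
  -- For `0 < x < 1` and `y > L ≥ 1`, monotonicity gives `K (x - y) ≤ K (y - 1)`, so this tail is
  -- uniform in `x`.
  have h2 : Tendsto (fun L : ℝ => ∫ y in Ioi L, K (y - 1)) atTop (𝓝 0) := by
    have := tendsto_setIntegral_of_antitone (μ := volume) (f := fun y => K (y - 1))
      (s := fun L : ℝ => Ioi L) (fun _ => measurableSet_Ioi) (fun a b hab => Ioi_subset_Ioi hab)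
      ⟨0, (hK.integrable.comp_sub_right 1).integrableOn⟩
    have e : ⋂ L : ℝ, Ioi L = ∅ := by
      rw [eq_empty_iff_forall_notMem]
      intro y hy
      exact lt_irrefl y (mem_iInter.1 hy y)
    simpa [e] using this
  obtain ⟨L, hLR, hL⟩ := ((eventually_ge_atTop (max R 1)).and
    (h2.eventually (gt_mem_nhds (half_pos hη)))).exists
  have hL1 : 1 ≤ L := (le_max_right _ _).trans hLR
  refine ⟨min r₁ 1, L, lt_min hr₁ one_pos, (le_max_left _ _).trans hLR, ?_⟩
  intro r hr hrr x hx hxr S hS hsub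
  have hr1 : r < r₁ := hrr.trans_le (min_le_left _ _)
  have hr2 : r < 1 := hrr.trans_le (min_le_right _ _)
  have hKx := hK.integrable.comp_sub_left x
  have b1 : ∫ y in Ioc 0 r, K (x - y) < η / 2 := by
    refine lt_of_le_of_lt ?_ (hr₁' (y := r) (by simpa [abs_of_pos hr] using hr1))
    rw [← intervalIntegral.integral_of_le hr.le, intervalIntegral.integral_comp_sub_left]
    exact intervalIntegral.integral_mono_interval (by linarith) (by linarith) (by linarith)
      (ae_restrict_of_ae hKnn) (hi _ _)
  have b2 : ∫ y in Ioi L, K (x - y) < η / 2 := by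
    refine lt_of_le_of_lt ?_ hL
    refine setIntegral_mono_on hKx.integrableOn (hK.integrable.comp_sub_right 1).integrableOn
      measurableSet_Ioi fun y hy => ?_
    have hy' : L < y := hy
    have e : K (x - y) = K (y - x) := by rw [← hK.even]; congr 1; ring
    rw [e]
    exact (hK.anti _ _ (by linarith) (by linarith)).le
  calc ∫ y in S, K (x - y) ≤ ∫ y in Ioc 0 r ∪ Ioi L, K (x - y) :=
        setIntegral_mono_set hKx.integrableOn (ae_restrict_of_ae (hK.nonneg_ae x))
          (LE.le.eventuallyLE hsub)
    _ = (∫ y in Ioc 0 r, K (x - y)) + ∫ y in Ioi L, K (x - y) :=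
        setIntegral_union (disjoint_left.2 fun y h h' => by
          have h1 := h.2
          have h2 : L < y := h'
          linarith) measurableSet_Ioi hKx.integrableOn hKx.integrableOn
    _ < η := by linarith

/-- Convexity gives `exp (θ u) ≤ (1 - θ) + θ exp u`, so shrinking a finite exponential moment brings
the weighted mass near at most 1, hence below `c`. The choice `θ = (c - 1) / (c + A)` lies in `(0,
1]` for every `A ≥ 0`. -/
lemma IsCuspKernel.exists_decay_rate {c : ℝ} (hc : 1 < c) :
    ∃ ν : ℝ, 0 < ν ∧ Integrable (fun x => K x * Real.exp (ν * |x|)) ∧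
      ∫ x, K x * Real.exp (ν * |x|) < c := by
  obtain ⟨ν₁, hν₁, hint⟩ := hK.exp_moment
  have hKnn : ∀ᵐ y : ℝ, 0 ≤ K y := ae_ne_zero.mono fun y hy => (hK.pos y hy).le
  set A := ∫ x, K x * Real.exp (ν₁ * |x|) with hA
  have hA0 : 0 ≤ A := integral_nonneg_of_ae (hKnn.mono fun x hx =>
    mul_nonneg hx (Real.exp_pos _).le)
  set θ := (c - 1) / (c + A) with hθ
  have hθ0 : 0 < θ := div_pos (by linarith) (by linarith)
  have hθ1 : θ ≤ 1 := (div_le_one (by linarith)).2 (by linarith)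
  have hle : ∀ᵐ x : ℝ, K x * Real.exp (θ * ν₁ * |x|) ≤
      (1 - θ) * K x + θ * (K x * Real.exp (ν₁ * |x|)) := by
    filter_upwards [hKnn] with x hx
    have h1 := convexOn_exp.2 (mem_univ 0) (mem_univ (ν₁ * |x|)) (sub_nonneg.2 hθ1) hθ0.le
      (by ring)
    simp only [smul_eq_mul, mul_zero, zero_add, Real.exp_zero, mul_one] at h1
    have h2 := mul_le_mul_of_nonneg_left h1 hx
    rw [mul_assoc θ]
    linarith
  have hi2 : Integrable fun x => (1 - θ) * K x + θ * (K x * Real.exp (ν₁ * |x|)) :=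
    (hK.integrable.const_mul _).add (hint.const_mul _)
  have hi : Integrable fun x => K x * Real.exp (θ * ν₁ * |x|) := by
    refine Integrable.mono' hi2
      (hK.integrable.aestronglyMeasurable.mul (Continuous.aestronglyMeasurable (by fun_prop))) ?_
    filter_upwards [hle, hKnn] with x hx hx0
    rwa [Real.norm_of_nonneg (mul_nonneg hx0 (Real.exp_pos _).le)]
  refine ⟨θ * ν₁, by positivity, hi, ?_⟩
  calc ∫ x, K x * Real.exp (θ * ν₁ * |x|)
      ≤ ∫ x, ((1 - θ) * K x + θ * (K x * Real.exp (ν₁ * |x|))) := integral_mono_ae hi hi2 hle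
    _ = (1 - θ) * (∫ x, K x) + θ * A := by
        rw [integral_add (hK.integrable.const_mul _) (hint.const_mul _), integral_const_mul,
          integral_const_mul]
    _ ≤ (1 - θ) * 1 + θ * A := by
        have := hK.integral_le_one
        have := sub_nonneg.2 hθ1
        gcongr
    _ < c := by
        have h1 : θ * (c + A) = c - 1 := div_mul_cancel₀ _ (by linarith)
        nlinarith

end

lemma exists_forall_lt_of_tendsto_cocompact {φ : ℝ → ℝ} (h0 : Tendsto φ (cocompact ℝ) (𝓝 0))
    {ε : ℝ} (hε : 0 < ε) : ∃ R, ∀ x, R < |x| → φ x < ε := by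
  have h1 := h0.eventually (gt_mem_nhds hε)
  rw [cocompact_eq_atBot_atTop, eventually_sup] at h1
  obtain ⟨b, hb⟩ := h1.1.exists_forall_of_atBot
  obtain ⟨t, ht⟩ := h1.2.exists_forall_of_atTop
  refine ⟨max |b| |t|, fun x hx => ?_⟩
  have h2 := (le_max_left |b| |t|).trans_lt hx
  have h3 := (le_max_right |b| |t|).trans_lt hx
  rcases abs_choice x with h | h
  · exact ht x (by linarith [le_abs_self t])
  · exact hb x (by linarith [neg_abs_le b])

/-! ### Continuation of the plane, the axis, monotonicity and decay. -/

section
variable {c : ℝ} {φ : ℝ → ℝ} (hφ : IsSteadySolution c φ)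
include hφ

/-- Compactness keeps the odd part positive on `[r, L]` for nearby positions. A negative minimum
beyond `L` contradicts `c - evenPart ≤ 1`. One before `r` contradicts the mass form of that bound:
the negativity set has mass below `η`, while `c - evenPart > η` near the plane. -/
lemma IsSteadySolution.eventually_good (hc : 1 < c) (h0 : Tendsto φ (cocompact ℝ) (𝓝 0)) {a₀ : ℝ}
    (h : ∀ x, 0 < x → 0 < oddPart φ a₀ x) (hlt : 2 * φ a₀ < c) :
    ∀ᶠ a in 𝓝 a₀, ∀ y, 0 < y → 0 ≤ oddPart φ a y := by
  have hcont := hφ.continuous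
  set η := (c - 2 * φ a₀) / 2 with hη
  have hη0 : 0 < η := by linarith
  -- control at infinity
  obtain ⟨R, hR⟩ := exists_forall_lt_of_tendsto_cocompact h0 (show (0 : ℝ) < (c - 1) / 2 by linarith)
  obtain ⟨r₀, L, hr₀, hL, hmass⟩ := isCuspKernel_kernel.exists_small_mass hη0 (|R| + |a₀| + 1)
  -- control near the plane
  have hE : Continuous fun z : ℝ × ℝ => evenPart φ z.1 z.2 := by unfold evenPart; fun_prop
  have hO : Continuous fun z : ℝ × ℝ => oddPart φ z.1 z.2 := by unfold oddPart; fun_prop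
  have h1 : ∀ᶠ z in 𝓝 (a₀, (0 : ℝ)), evenPart φ z.1 z.2 < c - η := by
    refine (hE.tendsto _).eventually (gt_mem_nhds ?_)
    simp only [evenPart, add_zero, sub_zero]
    linarith
  obtain ⟨r₁, hr₁, hnear⟩ := Metric.eventually_nhds_iff.1 h1
  set r := min r₀ r₁ / 2 with hr
  have hrpos : 0 < r := half_pos (lt_min hr₀ hr₁)
  have hrr₀ : r < r₀ := (half_lt_self (lt_min hr₀ hr₁)).trans_le (min_le_left _ _)
  have hrr₁ : r < r₁ := (half_lt_self (lt_min hr₀ hr₁)).trans_le (min_le_right _ _)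
  have hmid : ∀ᶠ a in 𝓝 a₀, ∀ y ∈ Icc r L, 0 < oddPart φ a y :=
    isCompact_Icc.eventually_forall_of_forall_eventually fun y hy =>
      (hO.tendsto _).eventually (lt_mem_nhds (h y (hrpos.trans_le hy.1)))
  filter_upwards [hmid, Metric.ball_mem_nhds a₀ hr₁, Metric.ball_mem_nhds a₀ one_pos]
    with a hmid har₁ ha1 y hy
  by_contra! hneg
  obtain ⟨x, hx, hxneg, hmin⟩ := hφ.exists_min_oddPart h0 hy hneg
  rw [Metric.mem_ball, Real.dist_eq] at har₁ ha1
  rcases lt_or_ge x r with hxr | hxr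
  · have h2 := hφ.sub_evenPart_le hx hxneg hmin
    have h3 := hmass r hrpos hrr₀ x hx hxr {y | 0 < y ∧ oddPart φ a y < 0}
      ((isOpen_lt continuous_const continuous_id).inter
        (isOpen_lt (hφ.continuous_oddPart a) continuous_const)).measurableSet (by
      rintro y ⟨hy0, hy1⟩
      by_contra hcon
      simp only [mem_union, mem_Ioc, mem_Ioi, not_or, not_and, not_le, not_lt] at hcon
      exact absurd (hmid y ⟨(hcon.1 hy0).le, hcon.2⟩) (not_lt.2 hy1.le))
    have h4 := hnear (y := (a, x)) (by
      rw [Prod.dist_eq, max_lt_iff]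
      refine ⟨har₁, ?_⟩
      rw [Real.dist_eq, sub_zero, abs_of_pos hx]
      exact hxr.trans hrr₁)
    simp only at h4
    linarith
  · rcases le_or_gt x L with hxL | hxL
    · exact absurd (hmid x ⟨hxr, hxL⟩) (not_lt.2 hxneg.le)
    · have h2 := hφ.sub_evenPart_le_one hx hxneg hmin
      obtain ⟨h3, h4⟩ := abs_lt.1 ha1
      have h5 := le_abs_self R
      have h6 := le_abs_self a₀
      have h7 := neg_abs_le a₀
      have h8 := hR (a + x) (lt_of_lt_of_le (by linarith) (le_abs_self _))
      have h9 := hR (a - x) (lt_of_lt_of_le (by linarith) (neg_le_abs _))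
      rw [evenPart] at h2
      linarith

/-- The positions up to which the plane can be moved from `-∞` are a closed half-line, and `φ` is
symmetric about its endpoint. -/
lemma IsSteadySolution.exists_axis (hc : 1 < c) (hne : φ ≠ 0) (hbot : Tendsto φ atBot (𝓝 0))
    (htop : Tendsto φ atTop (𝓝 0)) :
    ∃ a₀ : ℝ, (∀ a, (∀ b ≤ a, ∀ y, 0 < y → 0 ≤ oddPart φ b y) ↔ a ≤ a₀) ∧
      ∀ y, 0 < y → oddPart φ a₀ y = 0 := by
  have h0 : Tendsto φ (cocompact ℝ) (𝓝 0) := by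
    rw [cocompact_eq_atBot_atTop]; exact hbot.sup htop
  have hpos := hφ.pos hc hne h0
  have hcont := hφ.continuous
  set S : Set ℝ := {a | ∀ b ≤ a, ∀ y, 0 < y → 0 ≤ oddPart φ b y} with hS
  have hSne : S.Nonempty := by
    obtain ⟨N, _, hN⟩ := hφ.exists_badSet_eq_empty hc h0 hbot
    exact ⟨-N, fun b hb => badSet_eq_empty_iff.1 (hN b hb)⟩
  have hSbdd : BddAbove S := by
    by_contra hunb
    rw [not_bddAbove_iff] at hunb
    have hall : ∀ b y, 0 < y → 0 ≤ oddPart φ b y := fun b => by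
      obtain ⟨a, ha, hab⟩ := hunb b
      exact ha b hab.le
    -- If every position were admissible, reflection about `x / 2` would give `φ 0 ≤ φ x` for all `x
    -- > 0`, against decay and positivity.
    have hle : φ 0 ≤ 0 := by
      refine ge_of_tendsto htop ?_
      filter_upwards [eventually_gt_atTop 0] with x hx
      have := hall (x / 2) (x / 2) (by linarith)
      rw [oddPart, sub_self, add_halves] at this
      linarith
    exact absurd (hpos 0) (not_lt.2 hle)
  set a₀ := sSup S with ha₀
  have hbelow : ∀ b < a₀, ∀ y, 0 < y → 0 ≤ oddPart φ b y := fun b hb => by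
    obtain ⟨a, ha, hba⟩ := exists_lt_of_lt_csSup hSne hb
    exact ha b hba.le
  have hgood : ∀ y, 0 < y → 0 ≤ oddPart φ a₀ y := fun y hy => by
    have h1 : Tendsto (fun b => oddPart φ b y) (𝓝[<] a₀) (𝓝 (oddPart φ a₀ y)) := by
      refine (Continuous.tendsto ?_ a₀).mono_left nhdsWithin_le_nhds
      unfold oddPart; fun_prop
    refine ge_of_tendsto h1 ?_
    filter_upwards [self_mem_nhdsWithin] with b hb using hbelow b hb y hy
  have hmem : ∀ a, a ∈ S ↔ a ≤ a₀ := fun a =>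
    ⟨fun ha => le_csSup hSbdd ha, fun ha b hb => by
      rcases (hb.trans ha).lt_or_eq with h | h
      · exact hbelow b h
      · rw [h]; exact hgood⟩
  refine ⟨a₀, hmem, ?_⟩
  by_contra! hcon
  obtain ⟨y₁, hy₁, hy₁ne⟩ := hcon
  have hstrict := fun x (hx : 0 < x) => hφ.oddPart_pos_and_evenPart_lt hgood hy₁ hy₁ne hx
  have hle : 2 * φ a₀ ≤ c := by
    have h1 : Tendsto (evenPart φ a₀) (𝓝[>] 0) (𝓝 (evenPart φ a₀ 0)) :=
      ((hφ.continuous_evenPart a₀).tendsto 0).mono_left nhdsWithin_le_nhds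
    have h2 : evenPart φ a₀ 0 ≤ c := by
      refine le_of_tendsto h1 ?_
      filter_upwards [self_mem_nhdsWithin] with x hx using (hstrict x hx).2.le
    simp only [evenPart, add_zero, sub_zero] at h2
    linarith
  have hlt : 2 * φ a₀ < c := lt_of_le_of_ne hle (hφ.two_mul_ne_of_oddPart_pos hstrict)
  obtain ⟨δ, hδ, hball⟩ := Metric.eventually_nhds_iff.1
    (hφ.eventually_good hc h0 (fun x hx => (hstrict x hx).1) hlt)
  -- Asymmetry at `a₀` would permit a further step, contradicting the supremum.
  have h3 : a₀ + δ / 2 ∈ S := by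
    intro b hb
    rcases le_or_gt b a₀ with h | h
    · exact (hmem a₀).2 le_rfl b h
    · exact hball (by rw [Real.dist_eq, abs_of_pos (by linarith)]; linarith)
  have := (hmem _).1 h3
  linarith

/-- Two points are compared through the plane at their midpoint `a < a₀`. If the odd part about `a`
vanished, `φ` would have two axes and so be periodic with period `2 (a₀ - a)`, contradicting decay
and positivity. -/
lemma IsSteadySolution.strictMonoOn_Iic (hc : 1 < c) (hne : φ ≠ 0) (hbot : Tendsto φ atBot (𝓝 0))
    (htop : Tendsto φ atTop (𝓝 0)) {a₀ : ℝ}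
    (hgood : ∀ b ≤ a₀, ∀ y, 0 < y → 0 ≤ oddPart φ b y) (hsymm : ∀ x, φ x = φ (2 * a₀ - x)) :
    StrictMonoOn φ (Iic a₀) := by
  have h0 : Tendsto φ (cocompact ℝ) (𝓝 0) := by
    rw [cocompact_eq_atBot_atTop]; exact hbot.sup htop
  have hpos := hφ.pos hc hne h0
  intro y hy x hx hyx
  have hx' : x ≤ a₀ := hx
  set a := (x + y) / 2 with ha
  have haa : a < a₀ := by linarith
  obtain ⟨y₁, hy₁, hne₁⟩ : ∃ y₁, 0 < y₁ ∧ oddPart φ a y₁ ≠ 0 := by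
    by_contra! hcon
    have hsymm' : ∀ z, φ z = φ (2 * a - z) := by
      have key : ∀ z, a < z → φ z = φ (2 * a - z) := fun z hz => by
        have := hcon (z - a) (by linarith)
        simp only [oddPart] at this
        rw [show a + (z - a) = z by ring, show a - (z - a) = 2 * a - z by ring] at this
        linarith
      intro z
      rcases lt_trichotomy a z with h | h | h
      · exact key z h
      · rw [← h]; ring_nf
      · rw [key (2 * a - z) (by linarith)]; ring_nf
    have hper : Function.Periodic φ (2 * (a₀ - a)) := fun z => by
      rw [hsymm (z + 2 * (a₀ - a)), hsymm' z]; ring_nf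
    have h1 : Tendsto (fun n : ℕ => φ (0 + n • (2 * (a₀ - a)))) atTop (𝓝 0) := by
      refine htop.comp (tendsto_atTop_add_const_left _ _ ?_)
      simp only [nsmul_eq_mul]
      exact tendsto_natCast_atTop_atTop.atTop_mul_const (by linarith)
    have h2 : ∀ n : ℕ, φ (0 + n • (2 * (a₀ - a))) = φ 0 := fun n => (hper.nsmul n) 0
    simp only [h2] at h1
    exact (hpos 0).ne' (tendsto_nhds_unique tendsto_const_nhds h1)
  have h1 := (hφ.oddPart_pos_and_evenPart_lt (hgood a haa.le) hy₁ hne₁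
    (show 0 < (x - y) / 2 by linarith)).1
  simp only [oddPart] at h1
  rw [show a + (x - y) / 2 = x by rw [ha]; ring, show a - (x - y) / 2 = y by rw [ha]; ring] at h1
  linarith

/-- Exponential decay by comparison with an explicit supersolution. -/
lemma IsSteadySolution.exists_exp_decay (hc : 1 < c) (h0 : Tendsto φ (cocompact ℝ) (𝓝 0)) {ν : ℝ}
    (hν : 0 < ν) (hint : Integrable fun x => kernel x * Real.exp (ν * |x|))
    (hlt : ∫ x, kernel x * Real.exp (ν * |x|) < c) :
    ∃ C : ℝ, ∀ x, |φ x| ≤ C * Real.exp (-ν * |x|) := by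
  have hnn := hφ.nonneg hc h0
  have hK := isCuspKernel_kernel
  obtain ⟨M, hM⟩ := hφ.bounded
  have hM0 : 0 ≤ M := (abs_nonneg _).trans (hM 0)
  set A := ∫ x, kernel x * Real.exp (ν * |x|) with hA
  -- Where `φ < ε` the quadratic term costs at most `ε φ`; this choice keeps `c - ε` above 1 and at
  -- least `A`.
  set ε := min (c - 1) (c - A) / 2 with hε
  have hmin : 0 < min (c - 1) (c - A) := lt_min (by linarith) (by linarith)
  have hε0 : 0 < ε := half_pos hmin
  have hε1 : 1 < c - ε := by linarith [min_le_left (c - 1) (c - A)]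
  have hε2 : A ≤ c - ε := by linarith [min_le_right (c - 1) (c - A)]
  obtain ⟨R, hR⟩ := exists_forall_lt_of_tendsto_cocompact h0 hε0
  set C := M * Real.exp (ν * R) with hC
  have hC0 : 0 ≤ C := by positivity
  refine ⟨C, fun x => ?_⟩
  rw [abs_of_nonneg (hnn x)]
  -- The slack `δ` makes the difference negative near infinity, so a positive excess attains its
  -- maximum `m`. The maximum lies in `|x| > R`, because `C` makes the barrier at least `M`
  -- elsewhere.
  have key : ∀ δ : ℝ, 0 < δ → ∀ x, φ x ≤ C * Real.exp (-ν * |x|) + δ := by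
    intro δ hδ
    by_contra! hcon
    obtain ⟨x₁, hx₁⟩ := hcon
    set f : ℝ → ℝ := fun x => φ x - (C * Real.exp (-ν * |x|) + δ) with hf
    have hfc : Continuous f := by have := hφ.continuous; fun_prop
    have hfx₁ : 0 < f x₁ := sub_pos.2 hx₁
    obtain ⟨x₀, hmax⟩ := hfc.exists_forall_ge' x₁ (by
      filter_upwards [h0.eventually (gt_mem_nhds hδ)] with x hx
      have : 0 < Real.exp (-ν * |x|) := Real.exp_pos _
      have : f x < 0 := by simp only [hf]; nlinarith
      linarith)
    set m := f x₀ with hm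
    have hm0 : 0 < m := hfx₁.trans_le (hmax x₁)
    have hφx₀ : φ x₀ = C * Real.exp (-ν * |x₀|) + δ + m := by simp only [hm, hf]; ring
    have hRx₀ : R < |x₀| := by
      by_contra! hle
      have h1 : M ≤ C * Real.exp (-ν * |x₀|) := by
        rw [hC, mul_assoc, ← Real.exp_add]
        refine le_mul_of_one_le_right hM0 (Real.one_le_exp ?_)
        nlinarith
      have h2 := (le_abs_self _).trans (hM x₀)
      linarith
    have hsmall := hR x₀ hRx₀
    have i1 : Integrable fun y => kernel (x₀ - y) * Real.exp (ν * |x₀ - y|) :=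
      hint.comp_sub_left x₀
    have i2 := hK.integrable.comp_sub_left x₀
    have h1 : ∫ y, kernel (x₀ - y) * φ y ≤
        C * Real.exp (-ν * |x₀|) * A + (δ + m) * ∫ y, kernel y := by
      have e1 : A = ∫ y, kernel (x₀ - y) * Real.exp (ν * |x₀ - y|) :=
        (integral_sub_left_eq_self (fun y => kernel y * Real.exp (ν * |y|)) volume x₀).symm
      rw [e1, ← integral_sub_left_eq_self kernel volume x₀, ← integral_const_mul,
        ← integral_const_mul, ← MeasureTheory.integral_add (i1.const_mul _) (i2.const_mul _)]
      refine integral_mono_ae (hK.integrable_mul hφ.continuous hM x₀)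
        ((i1.const_mul _).add (i2.const_mul _)) ?_
      filter_upwards [hK.nonneg_ae x₀] with y hy
      have h2 : φ y ≤ C * Real.exp (-ν * |y|) + δ + m := by
        have := hmax y
        simp only [hf] at this
        linarith
      have h3 : Real.exp (-ν * |y|) ≤ Real.exp (-ν * |x₀|) * Real.exp (ν * |x₀ - y|) := by
        rw [← Real.exp_add]
        refine Real.exp_le_exp.2 ?_
        have := abs_sub_abs_le_abs_sub x₀ y
        nlinarith
      calc kernel (x₀ - y) * φ y
          ≤ kernel (x₀ - y) * (C * (Real.exp (-ν * |x₀|) * Real.exp (ν * |x₀ - y|)) + δ + m) := by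
            refine mul_le_mul_of_nonneg_left (h2.trans ?_) hy
            gcongr
        _ = _ := by ring
    rw [← hφ.eq_integral] at h1
    have h4 : (δ + m) * ∫ y, kernel y ≤ δ + m :=
      mul_le_of_le_one_right (by linarith) hK.integral_le_one
    have hE : 0 ≤ C * Real.exp (-ν * |x₀|) := by positivity
    have h5 : C * Real.exp (-ν * |x₀|) * A ≤ C * Real.exp (-ν * |x₀|) * (c - ε) :=
      mul_le_mul_of_nonneg_left hε2 hE
    have h6 : (c - ε) * φ x₀ ≤ c * φ x₀ - φ x₀ ^ 2 := by nlinarith [hnn x₀]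
    -- The exponential part of the barrier is absorbed by `A ≤ c - ε`; the constant part `δ + m`
    -- gives the strict contradiction through `1 < c - ε`.
    have h7 : δ + m < (c - ε) * (δ + m) := by nlinarith
    rw [hφx₀] at h6
    rw [hφx₀] at h1
    nlinarith
  exact le_of_forall_pos_le_add fun δ hδ => key δ hδ x

end

end Whitham

/-! ### The symmetry theorem. -/

theorem mainTheorem1 (c : ℝ) (hc : 1 < c) :
    ∃ ν : ℝ, 0 < ν ∧
      ∀ φ : ℝ → ℝ, Whitham.IsSteadySolution c φ → φ ≠ 0 →
        Tendsto φ atBot (𝓝 0) → Tendsto φ atTop (𝓝 0) →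
        (∃ N : ℝ, 0 < N ∧ ∀ a ≤ -N, Whitham.badSet φ a = ∅) ∧
        ∃ a₀ : ℝ,
          (∀ N : ℝ, 0 < N → (∀ a ≤ -N, Whitham.badSet φ a = ∅) →
            IsGreatest (Whitham.reachable φ N) a₀) ∧
          (∀ x ∈ Whitham.halfLine a₀, φ x = Whitham.reflect φ a₀ x) ∧
          (∀ x, φ x = φ (2 * a₀ - x)) ∧
          (∀ x, IsLocalMax φ x ↔ x = a₀) ∧
          StrictAntiOn φ (Ici a₀) ∧
          ∃ C : ℝ, ∀ x, |φ x| ≤ C * Real.exp (-ν * |x|) := by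
  obtain ⟨ν, hν, hint, hlt⟩ := Whitham.isCuspKernel_kernel.exists_decay_rate hc
  refine ⟨ν, hν, fun φ hφ hne hbot htop => ?_⟩
  have h0 : Tendsto φ (cocompact ℝ) (𝓝 0) := by
    rw [cocompact_eq_atBot_atTop]; exact hbot.sup htop
  refine ⟨hφ.exists_badSet_eq_empty hc h0 hbot, ?_⟩
  obtain ⟨a₀, hgood, haxis⟩ := hφ.exists_axis hc hne hbot htop
  have hhalf : ∀ x, a₀ < x → φ x = φ (2 * a₀ - x) := fun x hx => by
    have := haxis (x - a₀) (by linarith)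
    simp only [Whitham.oddPart] at this
    rw [show a₀ + (x - a₀) = x by ring, show a₀ - (x - a₀) = 2 * a₀ - x by ring] at this
    linarith
  have hsymm : ∀ x, φ x = φ (2 * a₀ - x) := fun x => by
    rcases lt_trichotomy a₀ x with h | h | h
    · exact hhalf x h
    · rw [← h]; ring_nf
    · rw [hhalf (2 * a₀ - x) (by linarith)]; ring_nf
  have hmono := hφ.strictMonoOn_Iic hc hne hbot htop ((hgood a₀).2 le_rfl) hsymm
  have hanti : StrictAntiOn φ (Ici a₀) := fun x hx y hy hxy => by
    have hx' : a₀ ≤ x := hx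
    have hy' : a₀ ≤ y := hy
    rw [hsymm x, hsymm y]
    exact hmono (by simp only [mem_Iic]; linarith) (by simp only [mem_Iic]; linarith) (by linarith)
  refine ⟨a₀, fun N _ hN => ⟨?_, ?_⟩, fun x hx => hhalf x hx, hsymm, fun x => ⟨fun hx => ?_, ?_⟩,
    hanti, hφ.exists_exp_decay hc h0 hν hint hlt⟩
  · refine ⟨(hgood (-N)).1 fun b hb => Whitham.badSet_eq_empty_iff.1 (hN b hb), fun b hb x hx => ?_⟩
    have h1 := Whitham.badSet_eq_empty_iff.2 ((hgood a₀).2 le_rfl b hb.2)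
    by_contra! hcon
    exact (eq_empty_iff_forall_notMem.1 h1 x) ⟨hx, hcon⟩
  · rintro a ⟨_, ha⟩
    refine (hgood a).1 fun b hb => Whitham.badSet_eq_empty_iff.1 ?_
    -- `reachable` only speaks of positions to the right of `-N`; those to the left are admissible
    -- by the choice of `N`.
    rcases le_total b (-N) with h | h
    · exact hN b h
    · rw [eq_empty_iff_forall_notMem]
      rintro x ⟨hx, hcon⟩
      exact absurd (ha b ⟨h, hb⟩ x hx) (not_le.2 hcon)
  -- Off the axis, strict monotonicity gives larger values at points arbitrarily close on the side
  -- facing `a₀`.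
  · rcases lt_trichotomy x a₀ with h | h | h
    · exfalso
      obtain ⟨y, hy1, hy2, hy3⟩ := ((hx.filter_mono (nhdsWithin_le_nhds (s := Ioi x))).and
        (Ioo_mem_nhdsGT h)).exists
      exact absurd hy1 (not_le.2 (hmono h.le (le_of_lt hy3) hy2))
    · exact h
    · exfalso
      obtain ⟨y, hy1, hy2, hy3⟩ := ((hx.filter_mono (nhdsWithin_le_nhds (s := Iio x))).and
        (Ioo_mem_nhdsLT h)).exists
      exact absurd hy1 (not_le.2 (hanti (le_of_lt hy2) h.le hy3))
  · rintro rfl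
    refine Eventually.of_forall fun y => ?_
    rcases le_total y x with h | h
    · exact hmono.monotoneOn h self_mem_Iic h
    · exact hanti.antitoneOn self_mem_Ici h h
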